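/- Throughout, $\nu$ is a valuation of rank one of a field $K$ (value group non-zero and archimedean), and $\mu$ is a valuation of $K[x]$ extending $\nu$. All valuations take values in one ordered abelian group $\Gamma'$ together with $\infty$; valuations of $K[x]$ take the value $\infty$ only at $0$. **Key polynomials, augmented valuations.** Let $v$ be a valuation of $K[x]$. Polynomials $f,g$ are $v$-equivalent if $v(f)=v(g)<v(f-g)$; $g$ $v$-divides $f$ if $f$ is $v$-equivalent to $hg$ for some $h\in K[x]$. A monic $\phi$ is a key polynomial for $v$ if $\deg f\ge\deg\phi$ whenever $\phi$ $v$-divides $f$, and if $\phi$ $v$-divides $f$ or $g$ whenever it $v$-divides $fg$. For $\gamma\in\Gamma'$, $\gamma>v(\phi)$, the augmented valuation $v'=[v;v'(\phi)=\gamma]$ is $v'(\sum_jf_j\phi^j)=\min_j(v(f_j)+j\gamma)$, where $\deg f_j<\deg\phi$. With $v=\nu$, $\deg\phi=1$ and $f_j\in K$ the same formula defines an augmented valuation of $\nu$. **Families.** Let $A$ be totally ordered, $(\mu_\alpha)_{\alpha\in A}$ valuations of $K[x]$, $(Q_\alpha)_{\alpha\in A}$ polynomials. * The family is *augmented iterated*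 if each $\alpha$ other than the smallest element of $A$ admits $\theta<\alpha$ such that $\mu_\alpha$ is an augmented valuation of $\mu_\theta$ with key polynomial $Q_\alpha$, and: (a) if $\alpha$ has an immediate predecessor, $\theta$ is that predecessor and, when $\theta$ is not the smallest element of $A$, $Q_\alpha,Q_\theta$ are not $\mu_\theta$-equivalent and $\deg Q_\theta\le\deg Q_\alpha$; (b) otherwise, for all $\theta<\beta<\alpha$, $\mu_\beta$ is an augmented valuation of $\mu_\theta$ with key polynomial $Q_\beta$, $\mu_\alpha$ is one of $\mu_\beta$ with key polynomial $Q_\alpha$, and $\deg Q_\alpha=\deg Q_\beta$. * An augmented iterated family is *exhaustive continued* if all $Q_\alpha$ have the same degree and there is a valuation $v$ of $K[x]$ such that every $\mu_\alpha$ is an augmented valuation of $v$ with key polynomial $Q_\alpha$, the set $\{\mu_\alpha(Q_\alpha)\}$ is an infinite subset, without maximum, of the value group of $v$, and every element of this value group lying strictly between $\mu_\alpha(Q_\alpha)$ and $\mu_\beta(Q_\beta)$, for some $\alpha<\beta$, belongs to this set. * $\phi$ *$A$-divides* $f$ if $\phi$ $\mu_\alpha$-divides $f$ for all $\alpha>\alpha_0$,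 for some $\alpha_0$. A monic $\phi$ is a *limit key polynomial* if it satisfies the two conditions for key polynomials with "$A$-divides" instead of "$v$-divides". If $\gamma>\mu_\alpha(\phi)$ for all $\alpha$, the *limit augmented valuation* is $\mu'(\sum_jf_j\phi^j)=\min_j(\mu_A(f_j)+j\gamma)$, $\deg f_j<\deg\phi$, where $\mu_A(f)$ is the eventually constant value of $\mu_\alpha(f)$. * An *admissible* family $F=(\mu_i)_{i\in I}$ with polynomials $(Q_i)_{i\in I}$ has $I=\bigsqcup_{1\le t<N}I^{(t)}$ (blocks ordered by $t$; at least one block; $N\le\infty$), $I^{(t)}=B^{(t)}\sqcup A^{(t)}$, $B^{(t)}<A^{(t)}$, with $B^{(t)}=\{1^{(t)},2^{(t)},\dots\}$ a non-empty initial segment of $\mathbb N$ and $A^{(t)}$ totally ordered, possibly empty. Each $(\mu_i)_{i\in I^{(t)}}$ is augmented iterated; $\deg Q_i$ is strictly increasing on $B^{(t)}$; if $A^{(t)}\ne\emptyset$, then $B^{(t)}=\{1^{(t)},\dots,n^{(t)}\}$ is finite, $\deg Q_\alpha=\deg Q_{n^{(t)}}$ for $\alpha\in A^{(t)}$, and $(\mu_\alpha)_{\alpha\in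 A^{(t)}}$ is exhaustive continued. Only the last block may have $A^{(t)}=\emptyset$. The valuation $\mu_{1^{(1)}}$ is an augmented valuation of $\nu$ with key polynomial $Q_{1^{(1)}}$ monic of degree one, and for $t\ge2$, $\mu_{1^{(t)}}$ is a limit augmented valuation of $(\mu_\alpha)_{\alpha\in A^{(t-1)}}$ with limit key polynomial $Q_{1^{(t)}}$. The indices $1^{(t)}$, $t\ge2$, are called limit indices. * $F$ is *admitted* for $\mu$ if for all $i$ and $f$ one has $\mu_i(f)\le\mu(f)$, with equality when $\deg f<\deg Q_i$, and for all $\theta\in A^{(t)}$, $\{\mu_\alpha(Q_\alpha):\alpha\in A^{(t)},\alpha>\theta\}=\{\mu(\phi):\phi\text{ monic},\deg\phi=\deg Q_\theta,\mu_\theta(\phi)<\mu(\phi)\}$. **Standard monomials.** Put $\beta_i=\mu_i(Q_i)$. For $j<i\le l$ in $I$ write $i=j+$ (relatively to $l$) if either $j=k^{(t)}$, $i=(k+1)^{(t)}$ are consecutive in $B^{(t)}$; or $j\in\{n^{(t)}\}\cup A^{(t)}$ and $i,l\in A^{(t)}$; or $j\in\{n^{(t)}\}\cup A^{(t)}$ (with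 $A^{(t)}\neq\emptyset$) and $i=1^{(t+1)}$. In these cases put $\alpha_i=\deg Q_i/\deg Q_j$. An $l$-standard monomial not involving $Q_l$ is a product $c\prod_{j<l}Q_j^{\gamma_j}$, $c\in K$, with finitely many $\gamma_j\neq0$, such that $\gamma_j<\alpha_{i}$ whenever $i=j+$, and such that for every $i$ at most one $j$ with $j+=i$ has $\gamma_j\ne0$. **Statement.** Let $F=(\mu_i)_{i\in I}$ be an admissible family which is admitted for $\mu$, with key polynomials $(Q_i)_{i\in I}$. Assume that for each limit index $i$ the value $\beta_i$ is bounded above by an element of the value group of $\nu$ (this is automatic if $\mu$ has rank one). Then for every $i\in I$ other than the smallest one there is $i_0\in I$, $i_0<i$, with $i=i_0+$ (relatively to $i$), such that $Q_i$ can be written as $$Q_i=Q_{i_0}^{\alpha_i}+\sum_{j=0}^{\alpha_i-1}\Bigl(\sum_{\gamma}c_{j\gamma}\mathbf Q^{\gamma}\Bigr)Q_{i_0}^j\quad\text{(finite sums)},\qquad \alpha_i=\frac{\deg Q_i}{\deg Q_{i_0}}\ge1,$$ where: 1. each $c_{j\gamma}\mathbf Q^\gamma$ is an $i_0$-standard monomial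 not involving $Q_{i_0}$; 2. $j\beta_{i_0}+\mu(c_{j\gamma}\mathbf Q^\gamma)\ge\alpha_i\beta_{i_0}$ for all the monomials that appear; 3. $\beta_i>\alpha_i\beta_{i_0}$; 4. $\mu_{i_0}(Q_i)<\mu(Q_i)$. If $i$ is not a limit index, $Q_i$ has minimal degree among the polynomials $f$ with $\mu_{i_0}(f)<\mu(f)$. If $i$ is a limit index, $\mu_{i'}(Q_i)<\mu(Q_i)$ for all $i'<i$, and $Q_i$ has minimal degree among the polynomials $f$ such that $\mu_{i'}(f)<\mu(f)$ for all $i'<i$. -/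

import Mathlib

open Polynomial

/-! ### Valuations of `K[x]`, key polynomials, augmented valuations

Valuations are written additively, with values in `WithTop Γ` for an ordered abelian group `Γ`. -/

namespace Vaquie

section Basic

variable {K : Type*} [Field K] {Γ : Type*} [AddCommGroup Γ] [LinearOrder Γ] [IsOrderedAddMonoid Γ]

/-- The value `⊤` is taken only at `0`. -/
def TrivialSupport (v : AddValuation K[X] (WithTop Γ)) : Prop :=
  ∀ f, v f = ⊤ → f = 0

/-- The valuation `ν` of a field has rank one: its value group is nonzero and archimedean. -/
def RankOne (ν : AddValuation K (WithTop Γ)) : Prop :=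
  (∃ a : K, a ≠ 0 ∧ 0 < ν a) ∧
    ∀ a b : K, a ≠ 0 → b ≠ 0 → 0 < ν a → ∃ n : ℕ, ν b ≤ n • ν a

/-- The value group of `v`. -/
def valueGroup (v : AddValuation K[X] (WithTop Γ)) : Set Γ :=
  {γ | ∃ f g : K[X], v f ≠ ⊤ ∧ v f = v g + (γ : WithTop Γ)}

/-- `in_v f = in_v g` in the graded algebra `⨁ P_β / P_β⁺` : both have the same finite value `β`
and the same class in `P_β / P_β⁺`. -/
def Equivalent (v : AddValuation K[X] (WithTop Γ)) (f g : K[X]) : Prop :=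
  v f = v g ∧ v f < v (f - g)

/-- `g` `v`-divides `f`. -/
def Divides (v : AddValuation K[X] (WithTop Γ)) (g f : K[X]) : Prop :=
  ∃ h : K[X], Equivalent v f (h * g)

/-- Key polynomial for `v`: `v`-minimal, `v`-irreducible and monic. -/
structure IsKeyPolynomial (v : AddValuation K[X] (WithTop Γ)) (φ : K[X]) : Prop where
  minimal : ∀ f : K[X], Divides v φ f → φ.degree ≤ f.degree
  irreducible : ∀ f g : K[X], Divides v φ (f * g) → Divides v φ f ∨ Divides v φ g
  monic : φ.Monic

/-- `v' = [v; v'(φ) = γ]`: on every `φ`-expansion `∑ c_j φ^j` (with `deg c_j < deg φ`) the value of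
`v'` is `min_j (v (c_j) + j γ)`. -/
structure IsAugmentedWith (v : AddValuation K[X] (WithTop Γ)) (φ : K[X]) (γ : Γ)
    (v' : AddValuation K[X] (WithTop Γ)) : Prop where
  key : IsKeyPolynomial v φ
  lt : v φ < (γ : WithTop Γ)
  value : v' φ = (γ : WithTop Γ)
  expansion : ∀ (m : ℕ) (c : ℕ → K[X]), (∀ j, (c j).degree < φ.degree) →
    v' (∑ j ∈ Finset.range (m + 1), c j * φ ^ j) =
      (Finset.range (m + 1)).inf fun j => v (c j) + j • (γ : WithTop Γ)

/-- `v'` is an augmented valuation of `v` with key polynomial `φ`. -/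
def IsAugmented (v : AddValuation K[X] (WithTop Γ)) (φ : K[X])
    (v' : AddValuation K[X] (WithTop Γ)) : Prop :=
  ∃ γ : Γ, IsAugmentedWith v φ γ v'

/-- `v'` is the augmented valuation of the valuation `ν` of the field `K`, with a key polynomial
`φ = x - a` of degree one: `v' (∑ a_j φ^j) = min_j (ν (a_j) + j γ)`. -/
def IsFirstAugmented (ν : AddValuation K (WithTop Γ)) (φ : K[X])
    (v' : AddValuation K[X] (WithTop Γ)) : Prop :=
  φ.Monic ∧ φ.natDegree = 1 ∧ ∃ γ : Γ, v' φ = (γ : WithTop Γ) ∧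
    ∀ (m : ℕ) (a : ℕ → K), v' (∑ j ∈ Finset.range (m + 1), C (a j) * φ ^ j) =
      (Finset.range (m + 1)).inf fun j => ν (a j) + j • (γ : WithTop Γ)

/-! ### Families of valuations -/

section Families

variable {I : Type*} [LinearOrder I]

/-- A family of augmented iterated valuations `F`, with key polynomials `Q`. -/
def IsAugmentedIterated (F : I → AddValuation K[X] (WithTop Γ)) (Q : I → K[X]) : Prop :=
  (∀ i, TrivialSupport (F i)) ∧
  ∀ α : I, ¬ IsMin α → ∃ θ : I, θ < α ∧ IsAugmented (F θ) (Q α) (F α) ∧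
    (∀ p : I, p ⋖ α → θ = p ∧
      (¬ IsMin θ → ¬ Equivalent (F θ) (Q α) (Q θ) ∧ (Q θ).degree ≤ (Q α).degree)) ∧
    ((¬ ∃ p : I, p ⋖ α) → ∀ β : I, θ < β → β < α →
      IsAugmented (F θ) (Q β) (F β) ∧ IsAugmented (F β) (Q α) (F α) ∧
        (Q α).degree = (Q β).degree)

/-- An exhaustive continued family of augmented iterated valuations. Here `v` is the common
valuation of which all the `F α` are augmented valuations, and `γ_α = F α (Q α)`. -/
def IsExhaustiveContinued (F : I → AddValuation K[X] (WithTop Γ)) (Q : I → K[X]) : Prop :=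
  IsAugmentedIterated F Q ∧
  ∃ v : AddValuation K[X] (WithTop Γ), TrivialSupport v ∧
    (∀ α, IsAugmented v (Q α) (F α)) ∧
    (∀ α β, (Q α).degree = (Q β).degree) ∧
    (∀ α, ∃ γ ∈ valueGroup v, F α (Q α) = (γ : WithTop Γ)) ∧
    (Set.range fun α => F α (Q α)).Infinite ∧
    (∀ α, ∃ β, F α (Q α) < F β (Q β)) ∧
    (∀ α β, α < β → ∀ γ ∈ valueGroup v, F α (Q α) < (γ : WithTop Γ) →
      (γ : WithTop Γ) < F β (Q β) → ∃ δ, F δ (Q δ) = (γ : WithTop Γ))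

/-- `g` `A`-divides `f`. -/
def FamilyDivides (F : I → AddValuation K[X] (WithTop Γ)) (g f : K[X]) : Prop :=
  ∃ α₀ : I, ∀ α, α₀ < α → Divides (F α) g f

/-- Limit key polynomial for the family `F`. -/
structure IsLimitKeyPolynomial (F : I → AddValuation K[X] (WithTop Γ)) (φ : K[X]) : Prop where
  monic : φ.Monic
  minimal : ∀ f : K[X], FamilyDivides F φ f → φ.degree ≤ f.degree
  irreducible : ∀ f g : K[X],
    FamilyDivides F φ (f * g) → FamilyDivides F φ f ∨ FamilyDivides F φ g

/-- `w = μ_A(f)` : the values `F α f` are eventually constant, equal to `w`. -/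
def IsStableValue (F : I → AddValuation K[X] (WithTop Γ)) (f : K[X]) (w : WithTop Γ) : Prop :=
  ∃ α₀ : I, ∀ α, α₀ ≤ α → F α f = w

/-- `v'` is a limit augmented valuation `[(F α)_α; v'(φ) = γ]` of the family `F`, with limit key
polynomial `φ`: on every `φ`-expansion, `v' (∑ c_j φ^j) = min_j (μ_A(c_j) + j γ)`. -/
def IsLimitAugmented (F : I → AddValuation K[X] (WithTop Γ)) (φ : K[X])
    (v' : AddValuation K[X] (WithTop Γ)) : Prop :=
  IsLimitKeyPolynomial F φ ∧ ∃ γ : Γ, (∀ α, F α φ < (γ : WithTop Γ)) ∧ v' φ = (γ : WithTop Γ) ∧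
    ∀ (m : ℕ) (c : ℕ → K[X]), (∀ j, (c j).degree < φ.degree) →
      ∃ w : ℕ → WithTop Γ, (∀ j, j ≤ m → IsStableValue F (c j) (w j)) ∧
        v' (∑ j ∈ Finset.range (m + 1), c j * φ ^ j) =
          (Finset.range (m + 1)).inf fun j => w j + j • (γ : WithTop Γ)

end Families

end Basic

/-! ### The index set of an admissible family -/

/-- The shape of the index set `I = ⋃_t I^(t)`, `I^(t) = B^(t) ∪ A^(t)`: there are `N` blocks
(numbered from `0`); `B^(t)` is the initial segment of `ℕ` (numbered from `0`) with `len t` elements,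
and `A^(t)` is a totally ordered set, possibly empty. -/
structure Shape where
  N : ℕ∞
  len : ℕ → ℕ∞
  A : ℕ → Type*
  ord : ∀ t, LinearOrder (A t)

instance (s : Shape) (t : ℕ) : LinearOrder (s.A t) := s.ord t

namespace Shape

/-- The block `I^(t) = B^(t) ∪ A^(t)`, all of `B^(t)` preceding all of `A^(t)`. -/
abbrev Block (s : Shape) (t : ℕ) : Type _ := {k : ℕ // (k : ℕ∞) < s.len t} ⊕ₗ s.A t

/-- The index set, ordered lexicographically: first by block, then inside the block. -/
abbrev Idx (s : Shape) : Type _ := Σₗ t : {t : ℕ // (t : ℕ∞) < s.N}, s.Block t.1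

/-- The index of the block `t` with local index `i`. -/
def idx (s : Shape) {t : ℕ} (ht : (t : ℕ∞) < s.N) (i : s.Block t) : s.Idx :=
  toLex ⟨⟨t, ht⟩, i⟩

/-- The element of `B^(t)` with number `k`. -/
def b (s : Shape) {t : ℕ} (ht : (t : ℕ∞) < s.N) (k : ℕ) (hk : (k : ℕ∞) < s.len t) : s.Idx :=
  s.idx ht (Sum.inlₗ ⟨k, hk⟩)

/-- The element `a` of `A^(t)`. -/
def a (s : Shape) {t : ℕ} (ht : (t : ℕ∞) < s.N) (a : s.A t) : s.Idx :=
  s.idx ht (Sum.inrₗ a)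

/-- `j` lies in `{n^(t)} ∪ A^(t)`, where `A^(t)` is nonempty and `n^(t)` is the last element
of `B^(t)`. -/
def InTail (s : Shape) (t : ℕ) (j : s.Idx) : Prop :=
  Nonempty (s.A t) ∧ ∃ ht : (t : ℕ∞) < s.N,
    (∃ x : s.A t, j = s.a ht x) ∨
    (∃ (k : ℕ) (hk : (k : ℕ∞) < s.len t), (k : ℕ∞) + 1 = s.len t ∧ j = s.b ht k hk)

/-- `i` is a limit index: the first index `1^(t)` of a block which is not the first block. -/
def IsLimitIdx (s : Shape) (i : s.Idx) : Prop :=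
  ∃ (t : ℕ) (ht : ((t + 1 : ℕ) : ℕ∞) < s.N) (h0 : ((0 : ℕ) : ℕ∞) < s.len (t + 1)),
    i = s.b ht 0 h0

/-- `i = j+`, relatively to `l` (`j < i ≤ l`):
* `j`, `i` are consecutive elements of some `B^(t)`; or
* `j ∈ {n^(t)} ∪ A^(t)` and `i ∈ A^(t)`, where also `l ∈ A^(t)`
  (all these steps do not change the degree of the key polynomial); or
* `j ∈ {n^(t)} ∪ A^(t)` and `i = 1^(t+1)` (this is the inessential case). -/
def IsPlus (s : Shape) (l j i : s.Idx) : Prop :=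
  j < i ∧ i ≤ l ∧
  ((∃ (t : ℕ) (ht : (t : ℕ∞) < s.N) (k : ℕ) (hk : (k : ℕ∞) < s.len t)
      (hk' : ((k + 1 : ℕ) : ℕ∞) < s.len t), j = s.b ht k hk ∧ i = s.b ht (k + 1) hk') ∨
   (∃ (t : ℕ) (ht : (t : ℕ∞) < s.N) (x y : s.A t),
      s.InTail t j ∧ i = s.a ht x ∧ l = s.a ht y) ∨
   (∃ (t : ℕ) (ht : ((t + 1 : ℕ) : ℕ∞) < s.N) (h0 : ((0 : ℕ) : ℕ∞) < s.len (t + 1)),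
      s.InTail t j ∧ i = s.b ht 0 h0))

end Shape

/-! ### Admissible and admitted families, standard monomials -/

section Admissible

variable {K : Type*} [Field K] {Γ : Type*} [AddCommGroup Γ] [LinearOrder Γ] [IsOrderedAddMonoid Γ]
variable (s : Shape)

/-- The block number `t` of the family `(F, Q)` is a simple admissible family. -/
structure IsSimpleAdmissible (F : s.Idx → AddValuation K[X] (WithTop Γ)) (Q : s.Idx → K[X])
    (t : ℕ) (ht : (t : ℕ∞) < s.N) : Prop where
  iterated : IsAugmentedIterated (fun i : s.Block t => F (s.idx ht i)) fun i => Q (s.idx ht i)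
  len_pos : 0 < s.len t
  degree_lt : ∀ (k : ℕ) (hk : (k : ℕ∞) < s.len t) (hk' : ((k + 1 : ℕ) : ℕ∞) < s.len t),
    (Q (s.b ht k hk)).degree < (Q (s.b ht (k + 1) hk')).degree
  len_finite : Nonempty (s.A t) → s.len t < ⊤
  degree_eq : ∀ (x : s.A t) (k : ℕ) (hk : (k : ℕ∞) < s.len t), (k : ℕ∞) + 1 = s.len t →
    (Q (s.a ht x)).degree = (Q (s.b ht k hk)).degree
  exhaustive : Nonempty (s.A t) →
    IsExhaustiveContinued (fun x : s.A t => F (s.a ht x)) fun x => Q (s.a ht x)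

/-- `F` is an admissible family of valuations of `K[x]` (over the valuation `ν` of `K`), with key
polynomials `Q`. -/
structure IsAdmissible (ν : AddValuation K (WithTop Γ))
    (F : s.Idx → AddValuation K[X] (WithTop Γ)) (Q : s.Idx → K[X]) : Prop where
  nonempty : 0 < s.N
  simple : ∀ (t : ℕ) (ht : (t : ℕ∞) < s.N), IsSimpleAdmissible s F Q t ht
  nondiscrete : ∀ t : ℕ, ((t + 1 : ℕ) : ℕ∞) < s.N → Nonempty (s.A t)
  first : ∀ (ht : ((0 : ℕ) : ℕ∞) < s.N) (h0 : ((0 : ℕ) : ℕ∞) < s.len 0),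
    IsFirstAugmented ν (Q (s.b ht 0 h0)) (F (s.b ht 0 h0))
  limit : ∀ (t : ℕ) (ht : (t : ℕ∞) < s.N) (ht' : ((t + 1 : ℕ) : ℕ∞) < s.N)
    (h0 : ((0 : ℕ) : ℕ∞) < s.len (t + 1)),
    IsLimitAugmented (fun x : s.A t => F (s.a ht x)) (Q (s.b ht' 0 h0)) (F (s.b ht' 0 h0))

/-- The family `F`, with key polynomials `Q`, is admitted for `μ`. -/
structure IsAdmitted (F : s.Idx → AddValuation K[X] (WithTop Γ)) (Q : s.Idx → K[X])
    (μ : AddValuation K[X] (WithTop Γ)) : Prop where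
  le : ∀ i f, F i f ≤ μ f
  eq_of_degree_lt : ∀ i f, f.degree < (Q i).degree → F i f = μ f
  values : ∀ (t : ℕ) (ht : (t : ℕ∞) < s.N) (θ : s.A t),
    {w : WithTop Γ | ∃ x : s.A t, θ < x ∧ w = F (s.a ht x) (Q (s.a ht x))} =
    {w : WithTop Γ | ∃ φ : K[X], φ.Monic ∧ φ.degree = (Q (s.a ht θ)).degree ∧
      F (s.a ht θ) φ < μ φ ∧ w = μ φ}

/-- The integer `α_i = deg Q_i / deg Q_j`, for `i = j+`. -/
noncomputable def alpha {s : Shape} (Q : s.Idx → K[X]) (j i : s.Idx) : ℕ :=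
  (Q i).natDegree / (Q j).natDegree

/-- The monomial `c ∏ Q_j ^ (e_j)`. -/
noncomputable def monomialOf {s : Shape} (Q : s.Idx → K[X]) (c : K) (e : s.Idx →₀ ℕ) : K[X] :=
  C c * e.prod fun j n => Q j ^ n

/-- `e` is the exponent of an `l`-standard monomial not involving `Q_l`: it only involves the
`Q_j` with `j < l`; one has `e_j < α_{j+}`; and among the `j` with the same `j+`, at most one has
`e_j ≠ 0`. -/
structure IsStandardExponent {s : Shape} (Q : s.Idx → K[X]) (l : s.Idx) (e : s.Idx →₀ ℕ) :
    Prop where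
  lt_of_ne_zero : ∀ j, e j ≠ 0 → j < l
  lt_alpha : ∀ j i, s.IsPlus l j i → e j < alpha Q j i
  unique : ∀ j j' i, s.IsPlus l j i → s.IsPlus l j' i → e j ≠ 0 → e j' ≠ 0 → j = j'

end Admissible

end Vaquie

/-!
Every valuation `F i` of an admitted family is the truncation of `μ` at `Q i` with the value
`β i = F i (Q i)`: it is bounded by `μ`, coincides with it in degrees less than `deg (Q i)`, and its
value on a `Q i`-expansion is the minimum of the values of the terms (`IsTruncation`). Once this is
known, the theory of key polynomials is replaced by one remark (`map_mul_add_le`): if `v ≤ μ`, with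
equality at `r` and strict inequality at `Q`, then the initial forms of `q * Q` and `r` for `v`
cannot cancel, since otherwise `μ r` would exceed `v r`. It follows that carries are negligible in
products of two polynomials of degree less than `deg (Q i)`, and that within a set `A^(t)` the
valuation `F x` may be computed on `Q y`-expansions for every `y ≥ x`.

If `F i` is an augmentation of `F j`, then `Q i` is a monic polynomial of minimal degree among those
whose value increases. Discarding the terms of its `Q j`-expansion beyond the last one of minimal
value, and multiplying by a polynomial which lowers the degree of the leading coefficient modulo
`Q j`, would each produce a polynomial of smaller degree whose value increases; so the last term of
minimal value is the leading one, and its coefficient is `1` (`leading_coeff_eq_one_of_minimal`).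

For a limit index the same argument applies to the `Q z`-expansion for a suitable `z` in `A^(t)`,
provided the errors exceed the values `F y (Q i)` for all `y`. As a function of `β x`, the value
`F x (Q i)` is concave and piecewise linear with slopes in `ℕ`, hence eventually linear with some
slope `δ` (`exists_eventual_slope`). The values `β x` are torsion over the value group of `ν`
(`hasTorsionValue_b`), where the archimedean property holds, and they are bounded if `δ` is positive.
So they cannot grow geometrically, and for some `z` the whole remaining growth of `δ • β x` beyond
`z` is less than `β z - β y`, for a fixed `y` at which the slope is already stable
(`exists_small_growth`). The errors at `z` are larger than that.

Expanding the coefficients successively in key polynomials of smaller degree, always with one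
element of each `A^(t)`, yields standard monomials; the expansion in `Q j` does not decrease values,
because the truncation computes the value of the coefficient (`mem_standardSums`). The exponents
satisfy the required bounds because the monic expansions give `deg (Q i) = α i * deg (Q j)`.
-/

namespace Vaquie

/-! ### Values on `Q`-expansions -/

section Expansions

variable {K : Type*} [Field K] {Γ : Type*} [AddCommGroup Γ] [LinearOrder Γ] [IsOrderedAddMonoid Γ]

theorem lt_map_sub {v : AddValuation K[X] (WithTop Γ)} {f g : K[X]} {w : WithTop Γ}
    (hf : w < v f) (hg : w < v g) : w < v (f - g) := by
  rw [sub_eq_add_neg]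
  exact v.map_lt_add hf (by rwa [v.map_neg])

/-- If `v ≤ μ`, with equality at `r` and strict inequality at `Q`, the initial forms of `q * Q`
and `r` cannot cancel: such a cancellation would force `μ r > v r`. -/
theorem map_mul_add_le {v μ : AddValuation K[X] (WithTop Γ)} (hle : ∀ f, v f ≤ μ f)
    {Q q r : K[X]} (hr : v r = μ r) (hQ : v Q < μ Q) : v (q * Q + r) ≤ v (q * Q) := by
  by_contra! h
  have hfin : v (q * Q) ≠ ⊤ := h.ne_top
  have h1 : v r = v (q * Q) := by
    rw [← v.map_neg r]
    refine v.map_eq_of_lt_sub ?_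
    rwa [show -r - q * Q = -(q * Q + r) by ring, v.map_neg]
  have h2 : v (q * Q) < μ (q * Q) := by
    rw [v.map_mul] at hfin
    rw [v.map_mul, μ.map_mul]
    calc v q + v Q < v q + μ Q := (WithTop.add_lt_add_iff_left (WithTop.add_ne_top.1 hfin).1).2 hQ
      _ ≤ μ q + μ Q := by gcongr; exact hle q
  have h3 : v (q * Q) < μ r := by
    rw [show r = (q * Q + r) - q * Q by ring]
    exact lt_map_sub (h.trans_le (hle _)) h2
  exact absurd h3 (by rw [← hr, h1]; exact lt_irrefl _)

theorem map_mul_add_le_right {v μ : AddValuation K[X] (WithTop Γ)} (hle : ∀ f, v f ≤ μ f)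
    {Q q r : K[X]} (hr : v r = μ r) (hQ : v Q < μ Q) : v (q * Q + r) ≤ v r := by
  have h := map_mul_add_le hle hr hQ (q := q)
  conv_rhs => rw [show r = (q * Q + r) - q * Q by ring]
  exact v.map_le_sub le_rfl h

/-- On `Q`-expansions whose coefficients have the same value under `v` and `μ`, the valuation `v`
is at most the minimum of the values of the terms, provided `v ≤ μ` and `v Q < μ Q`. -/
theorem map_sum_le {v μ : AddValuation K[X] (WithTop Γ)} (hle : ∀ f, v f ≤ μ f) {Q : K[X]}
    (hQ : v Q < μ Q) (n : ℕ) (c : ℕ → K[X]) (hc : ∀ j, v (c j) = μ (c j)) {j : ℕ} (hj : j < n) :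
    v (∑ k ∈ Finset.range n, c k * Q ^ k) ≤ μ (c j) + j • v Q := by
  induction n generalizing c j with
  | zero => omega
  | succ n ih =>
    have hsum : ∑ k ∈ Finset.range (n + 1), c k * Q ^ k
        = (∑ k ∈ Finset.range n, c (k + 1) * Q ^ k) * Q + c 0 := by
      rw [Finset.sum_range_succ', Finset.sum_mul]
      congr 1
      · exact Finset.sum_congr rfl fun k _ => by ring
      · simp
    rw [hsum]
    cases j with
    | zero => simpa [← hc 0] using map_mul_add_le_right hle (hc 0) hQ
    | succ j =>
      refine (map_mul_add_le hle (hc 0) hQ).trans ?_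
      rw [v.map_mul, succ_nsmul, ← add_assoc]
      gcongr
      exact ih (fun k => c (k + 1)) (fun k => hc _) (by omega)

theorem le_map_sum (v : AddValuation K[X] (WithTop Γ)) {Q : K[X]} {s : Finset ℕ} {c : ℕ → K[X]}
    {w : WithTop Γ} (h : ∀ j ∈ s, w ≤ v (c j) + j • v Q) : w ≤ v (∑ j ∈ s, c j * Q ^ j) :=
  v.map_le_sum fun j hj => by simpa [v.map_mul, v.map_pow] using h j hj

theorem lt_map_sum (v : AddValuation K[X] (WithTop Γ)) {Q : K[X]} {s : Finset ℕ} {c : ℕ → K[X]}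
    {w : WithTop Γ} (hw : w ≠ ⊤) (h : ∀ j ∈ s, w < v (c j) + j • v Q) :
    w < v (∑ j ∈ s, c j * Q ^ j) :=
  v.map_lt_sum hw fun j hj => by simpa [v.map_mul, v.map_pow] using h j hj

theorem exists_expansion {Q : K[X]} (hQ : Q.Monic) (n : ℕ) (f : K[X])
    (hf : f.natDegree < (n + 1) * Q.natDegree) :
    ∃ c : ℕ → K[X], (∀ j, (c j).degree < Q.degree) ∧
      f = ∑ j ∈ Finset.range (n + 1), c j * Q ^ j := by
  have hpos : 0 < Q.natDegree := Nat.pos_of_ne_zero fun h => by simp [h] at hf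
  have hlt : ∀ {g : K[X]}, g.natDegree < Q.natDegree → g.degree < Q.degree := fun h =>
    degree_lt_degree h
  induction n generalizing f with
  | zero => exact ⟨fun _ => f, fun _ => hlt (by simpa using hf), by simp⟩
  | succ n ih =>
    obtain ⟨c, hc, hsum⟩ := ih (f /ₘ Q) (by
      rw [natDegree_divByMonic f hQ]
      have : (n + 1 + 1) * Q.natDegree = (n + 1) * Q.natDegree + Q.natDegree := by ring
      have : 0 < (n + 1) * Q.natDegree := by positivity
      omega)
    refine ⟨fun j => if j = 0 then f %ₘ Q else c (j - 1), fun j => ?_, ?_⟩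
    · by_cases hj : j = 0
      · simpa [hj] using degree_modByMonic_lt f hQ
      · simpa [hj] using hc (j - 1)
    · rw [Finset.sum_range_succ']
      conv_lhs => rw [← modByMonic_add_div f Q, hsum, add_comm, Finset.mul_sum]
      congr 1
      · refine Finset.sum_congr rfl fun k _ => ?_
        simp only [Nat.add_eq_zero_iff, one_ne_zero, and_false, if_false, Nat.add_sub_cancel]
        ring
      · simp

theorem degree_term_lt {Q c : K[X]} (hQ : Q.Monic) (hc : c.degree < Q.degree) (j : ℕ) :
    (c * Q ^ j).degree < (((j + 1) * Q.natDegree : ℕ) : WithBot ℕ) := by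
  by_cases h0 : c = 0
  · rw [h0, zero_mul, degree_zero]
    exact WithBot.bot_lt_coe _
  have h1 : (c * Q ^ j).natDegree = c.natDegree + j * Q.natDegree := by
    rw [natDegree_mul h0 (hQ.pow j).ne_zero, natDegree_pow]
  have h2 : c.natDegree < Q.natDegree := natDegree_lt_natDegree h0 hc
  rw [degree_eq_natDegree (mul_ne_zero h0 (hQ.pow j).ne_zero), h1]
  have h3 : c.natDegree + j * Q.natDegree < (j + 1) * Q.natDegree := by
    rw [add_mul]
    omega
  exact_mod_cast h3

theorem degree_sum_lt {Q : K[X]} (hQ : Q.Monic) {c : ℕ → K[X]} (hc : ∀ j, (c j).degree < Q.degree)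
    (n : ℕ) : (∑ j ∈ Finset.range n, c j * Q ^ j).degree < ((n * Q.natDegree : ℕ) : WithBot ℕ) := by
  rw [← mem_degreeLT]
  refine Submodule.sum_mem _ fun j hj => mem_degreeLT.2 ((degree_term_lt hQ (hc j) j).trans_le ?_)
  exact WithBot.coe_le_coe.2 (Nat.mul_le_mul_right _ (Finset.mem_range.1 hj))

theorem natDegree_sum_eq {Q : K[X]} (hQ : Q.Monic) {c : ℕ → K[X]}
    (hc : ∀ j, (c j).degree < Q.degree) {r : ℕ} (hr : c r ≠ 0) :
    (∑ j ∈ Finset.range (r + 1), c j * Q ^ j).natDegree = (c r).natDegree + r * Q.natDegree ∧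
    (∑ j ∈ Finset.range (r + 1), c j * Q ^ j).leadingCoeff = (c r).leadingCoeff := by
  have h1 : (c r * Q ^ r).natDegree = (c r).natDegree + r * Q.natDegree := by
    rw [natDegree_mul hr (hQ.pow r).ne_zero, natDegree_pow]
  have h2 : (∑ j ∈ Finset.range r, c j * Q ^ j).degree < (c r * Q ^ r).degree := by
    refine (degree_sum_lt hQ hc r).trans_le ?_
    rw [degree_eq_natDegree (mul_ne_zero hr (hQ.pow r).ne_zero), h1]
    exact WithBot.coe_le_coe.2 (Nat.le_add_left _ _)
  rw [Finset.sum_range_succ]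
  refine ⟨?_, ?_⟩
  · rw [natDegree_add_eq_right_of_degree_lt h2, h1]
  · rw [leadingCoeff_add_of_degree_lt h2, leadingCoeff_mul, (hQ.pow r).leadingCoeff, mul_one]

/-! ### Truncations -/

/-- `F` is the truncation of `μ` at the monic nonconstant polynomial `Q`, with the value `γ`: it is
bounded by `μ`, coincides with `μ` in degrees less than `deg Q`, and its value on a `Q`-expansion
is the minimum of the values of the terms, `Q` having value `γ`. -/
structure IsTruncation (μ F : AddValuation K[X] (WithTop Γ)) (Q : K[X]) (γ : Γ) : Prop where
  monic : Q.Monic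
  natDegree_pos : 0 < Q.natDegree
  le : ∀ f, F f ≤ μ f
  eq_of_degree_lt : ∀ f : K[X], f.degree < Q.degree → F f = μ f
  value : F Q = (γ : WithTop Γ)
  expansion : ∀ (m : ℕ) (c : ℕ → K[X]), (∀ j, (c j).degree < Q.degree) →
    F (∑ j ∈ Finset.range (m + 1), c j * Q ^ j) =
      (Finset.range (m + 1)).inf fun j => μ (c j) + j • (γ : WithTop Γ)

namespace IsTruncation

variable {μ F G : AddValuation K[X] (WithTop Γ)} {Q : K[X]} {γ : Γ}

theorem map_le (h : IsTruncation μ F Q γ) {m : ℕ} {c : ℕ → K[X]}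
    (hc : ∀ j, (c j).degree < Q.degree) {j : ℕ} (hj : j < m + 1) :
    F (∑ j ∈ Finset.range (m + 1), c j * Q ^ j) ≤ μ (c j) + j • (γ : WithTop Γ) := by
  rw [h.expansion m c hc]
  exact Finset.inf_le (f := fun j => μ (c j) + j • (γ : WithTop Γ)) (Finset.mem_range.2 hj)

theorem exists_map_eq (h : IsTruncation μ F Q γ) {m : ℕ} {c : ℕ → K[X]}
    (hc : ∀ j, (c j).degree < Q.degree) : ∃ j < m + 1,
    F (∑ j ∈ Finset.range (m + 1), c j * Q ^ j) = μ (c j) + j • (γ : WithTop Γ) := by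
  obtain ⟨j, hj, hj'⟩ := Finset.exists_mem_eq_inf (Finset.range (m + 1)) ⟨0, by simp⟩
    fun j => μ (c j) + j • (γ : WithTop Γ)
  exact ⟨j, Finset.mem_range.1 hj, by rw [h.expansion m c hc, hj']⟩

theorem exists_expansion (h : IsTruncation μ F Q γ) (f : K[X]) : ∃ (n : ℕ) (c : ℕ → K[X]),
    (∀ j, (c j).degree < Q.degree) ∧ f = ∑ j ∈ Finset.range (n + 1), c j * Q ^ j := by
  refine ⟨f.natDegree, Vaquie.exists_expansion h.monic f.natDegree f ?_⟩
  exact (Nat.lt_succ_self _).trans_le (Nat.le_mul_of_pos_right _ h.natDegree_pos)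

/-- A truncation at `Q` is the least valuation which coincides with `μ` in degrees less than
`deg Q` and has at least the given value at `Q`. -/
theorem le_of_le (h : IsTruncation μ F Q γ) (hG : ∀ f : K[X], f.degree < Q.degree → G f = μ f)
    (hγ : (γ : WithTop Γ) ≤ G Q) (f : K[X]) : F f ≤ G f := by
  obtain ⟨n, c, hc, rfl⟩ := h.exists_expansion f
  refine le_map_sum G fun j hj => (h.map_le hc (Finset.mem_range.1 hj)).trans ?_
  rw [hG _ (hc j)]
  gcongr

theorem map_add_self (h : IsTruncation μ F Q γ) {r : K[X]} (hr : r.degree < Q.degree) :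
    F (Q + r) = min (γ : WithTop Γ) (μ r) := by
  have h1 : (1 : K[X]).degree < Q.degree := degree_lt_degree (by simpa using h.natDegree_pos)
  have := h.expansion 1 (fun j => if j = 0 then r else 1) fun j => by
    by_cases hj : j = 0
    · simpa [hj] using hr
    · simpa only [hj, if_false] using h1
  rw [Finset.sum_range_succ, Finset.sum_range_one] at this
  simp only [if_true, one_ne_zero, if_false, pow_zero, pow_one, one_mul, mul_one,
    Finset.range_add_one, Finset.inf_insert] at this
  rw [add_comm, this]
  simp [μ.map_one, min_def]

theorem one_degree_lt (h : IsTruncation μ F Q γ) : (1 : K[X]).degree < Q.degree :=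
  degree_lt_degree (by simpa using h.natDegree_pos)

end IsTruncation

end Expansions

end Vaquie

namespace Vaquie

section Leading

variable {K : Type*} [Field K] {Γ : Type*} [AddCommGroup Γ] [LinearOrder Γ] [IsOrderedAddMonoid Γ]
variable {μ F : AddValuation K[X] (WithTop Γ)} {Q : K[X]} {γ : Γ}

/-- Let `P` be monic with `Q`-expansion `∑ c j * Q ^ j`. The set `E` measures how far the truncated
value of `P` may still grow: `h1` says that the terms beyond the index `δ` exceed the value of `P`
by more than any `e ∈ E`, `h2` that carries in products of two polynomials of degree less than
`deg Q` are that negligible, and `h3` that no polynomial of degree less than `deg P` approximates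
a multiple of `P` up to such an error. Then the expansion is monic with leading index `δ`. -/
theorem leading_coeff_eq_one_of_minimal (hμ : TrivialSupport μ) (hT : IsTruncation μ F Q γ)
    {P : K[X]} (hP : P.Monic) {r δ : ℕ} {c : ℕ → K[X]} (hc : ∀ j, (c j).degree < Q.degree)
    (hPc : P = ∑ j ∈ Finset.range (r + 1), c j * Q ^ j) (hr : c r ≠ 0) (hδr : δ ≤ r)
    (E : Set Γ)
    (h1 : ∀ j, δ < j → j ≤ r → ∀ e ∈ E, F P + (e : WithTop Γ) < μ (c j) + j • (γ : WithTop Γ))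
    (h2 : ∀ a b q d : K[X], a ≠ 0 → b ≠ 0 → a.degree < Q.degree → b.degree < Q.degree →
      q.degree < Q.degree → d.degree < Q.degree → a * b = q * Q + d →
      ∀ e ∈ E, μ a + μ b + (e : WithTop Γ) < μ q + (γ : WithTop Γ))
    (h3 : ∀ q f : K[X], q ≠ 0 → q.degree < Q.degree →
      (∀ e ∈ E, F P + μ q + (e : WithTop Γ) < F (f - q * P)) → P.degree ≤ f.degree) :
    δ = r ∧ c r = 1 := by
  have hfin : ∀ f : K[X], f ≠ 0 → μ f ≠ ⊤ := fun f hf h => hf (hμ f h)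
  have hFP : F P ≠ ⊤ := fun h => hfin P hP.ne_zero (top_le_iff.1 (h ▸ hT.le P))
  obtain ⟨hnat, hlead⟩ := natDegree_sum_eq hT.monic hc hr
  rw [← hPc] at hnat hlead
  have hPdeg : P.degree = ((c r).natDegree + r * Q.natDegree : ℕ) := by
    rw [degree_eq_natDegree hP.ne_zero, hnat]
  have hδ : δ = r := by
    by_contra hne
    have hlt : δ < r := lt_of_le_of_ne hδr hne
    set f := ∑ j ∈ Finset.range (δ + 1), c j * Q ^ j with hf
    have hdeg : f.degree < P.degree := by
      refine (degree_sum_lt hT.monic hc (δ + 1)).trans_le ?_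
      rw [hPdeg]
      have : (δ + 1) * Q.natDegree ≤ (c r).natDegree + r * Q.natDegree :=
        (Nat.mul_le_mul_right _ hlt).trans (Nat.le_add_left _ _)
      exact_mod_cast this
    refine absurd (h3 1 f one_ne_zero hT.one_degree_lt fun e he => ?_) (not_le.2 hdeg)
    have hsub : f - 1 * P = -∑ j ∈ Finset.Ico (δ + 1) (r + 1), c j * Q ^ j := by
      rw [Finset.sum_Ico_eq_sub _ (by omega), ← hPc, ← hf]
      ring
    rw [hsub, F.map_neg, μ.map_one, add_zero]
    refine lt_map_sum F (WithTop.add_ne_top.2 ⟨hFP, WithTop.coe_ne_top⟩) fun j hj => ?_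
    rw [Finset.mem_Ico] at hj
    rw [hT.eq_of_degree_lt _ (hc j), hT.value]
    exact h1 j (by omega) (by omega) e he
  refine ⟨hδ, ?_⟩
  have hmon : (c r).Monic := by rw [Monic, ← hlead, hP.leadingCoeff]
  by_contra hne
  have hdpos : 0 < (c r).natDegree := Nat.pos_of_ne_zero fun h => hne (hmon.natDegree_eq_zero.1 h)
  have hdlt : (c r).natDegree < Q.natDegree := natDegree_lt_natDegree hr (hc r)
  -- `q * c r` is, up to a multiple of `Q`, of degree less than `deg (c r)`.
  set q := Q /ₘ c r with hq
  set s := Q %ₘ c r with hs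
  have hqs : s + c r * q = Q := modByMonic_add_div Q (c r)
  have hsdeg : s.degree < (c r).degree := degree_modByMonic_lt Q hmon
  have hqnat : q.natDegree = Q.natDegree - (c r).natDegree := natDegree_divByMonic Q hmon
  have hq0 : q ≠ 0 := fun h => by
    rw [h, natDegree_zero] at hqnat
    omega
  have hqdeg : q.degree < Q.degree := degree_lt_degree (by omega)
  set u : ℕ → K[X] := fun j => (q * c j) /ₘ Q with hu
  set d : ℕ → K[X] := fun j => (q * c j) %ₘ Q with hd
  have hud : ∀ j, q * c j = u j * Q + d j := fun j => by
    rw [hu, hd, mul_comm (_ /ₘ Q), add_comm]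
    exact (modByMonic_add_div _ Q).symm
  have hddeg : ∀ j, (d j).degree < Q.degree := fun j => degree_modByMonic_lt _ hT.monic
  have hdr : d r = -s := by
    refine (div_modByMonic_unique 1 (-s) hT.monic ⟨?_, ?_⟩).2
    · rw [← hqs]
      ring
    · rw [degree_neg]
      exact hsdeg.trans (hc r)
  have hudeg : ∀ j, (u j).degree < Q.degree := fun j => by
    refine degree_lt_degree ?_
    rw [hu]
    simp only
    rw [natDegree_divByMonic _ hT.monic]
    have h1 := natDegree_mul_le (p := q) (q := c j)
    have h2 : (c j).natDegree < Q.natDegree := by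
      by_cases h0 : c j = 0
      · simpa [h0] using hT.natDegree_pos
      · exact natDegree_lt_natDegree h0 (hc j)
    omega
  set f := ∑ j ∈ Finset.range (r + 1), d j * Q ^ j with hf
  have hdeg : f.degree < P.degree := by
    rw [hf, Finset.sum_range_succ]
    refine (degree_add_le _ _).trans_lt (max_lt ?_ ?_)
    · refine (degree_sum_lt hT.monic hddeg r).trans_le ?_
      rw [hPdeg]
      exact_mod_cast Nat.le_add_left _ _
    · rw [hdr, hPdeg, degree_mul, degree_neg, degree_pow, degree_eq_natDegree hT.monic.ne_zero]
      rw [degree_eq_natDegree hr] at hsdeg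
      push_cast
      rw [nsmul_eq_mul]
      refine WithBot.add_lt_add_right ?_ hsdeg
      exact_mod_cast WithBot.coe_ne_bot
  refine absurd (h3 q f hq0 hqdeg fun e he => ?_) (not_le.2 hdeg)
  have hsub : f - q * P = -∑ j ∈ Finset.range (r + 1), (u j * Q) * Q ^ j := by
    rw [hPc, Finset.mul_sum, hf, ← Finset.sum_sub_distrib, ← Finset.sum_neg_distrib]
    refine Finset.sum_congr rfl fun j _ => ?_
    rw [← mul_assoc, hud j]
    ring
  rw [hsub, F.map_neg]
  have hLHS : F P + μ q + (e : WithTop Γ) ≠ ⊤ :=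
    WithTop.add_ne_top.2 ⟨WithTop.add_ne_top.2 ⟨hFP, hfin q hq0⟩, WithTop.coe_ne_top⟩
  refine lt_map_sum F hLHS fun j hj => ?_
  rw [F.map_mul, hT.eq_of_degree_lt _ (hudeg j), hT.value]
  by_cases h0 : c j = 0
  · have : u j = 0 := by simp [hu, h0]
    rw [this, μ.map_zero, top_add, top_add]
    exact lt_top_iff_ne_top.2 hLHS
  have hle : F P ≤ μ (c j) + j • (γ : WithTop Γ) := by
    rw [hPc]
    exact hT.map_le hc (Finset.mem_range.1 hj)
  have hlt := h2 q (c j) (u j) (d j) hq0 h0 hqdeg (hc j) (hudeg j) (hddeg j) (hud j) e he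
  calc F P + μ q + (e : WithTop Γ) ≤ (μ (c j) + j • (γ : WithTop Γ)) + μ q + e := by gcongr
    _ = (μ q + μ (c j) + e) + j • (γ : WithTop Γ) := by abel
    _ < (μ (u j) + γ) + j • (γ : WithTop Γ) := by
      refine (WithTop.add_lt_add_iff_right ?_).2 hlt
      rw [← WithTop.coe_nsmul]
      exact WithTop.coe_ne_top

/-- The `Q`-expansion of `P` is `Q ^ r + ∑_{j < r} c j * Q ^ j`, and the truncated value of `P` is
that of its leading term. -/
structure HasMonicExpansion (μ F : AddValuation K[X] (WithTop Γ)) (Q P : K[X]) (γ : Γ)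
    (r : ℕ) (c : ℕ → K[X]) : Prop where
  degree_lt : ∀ j, (c j).degree < Q.degree
  eq : P = Q ^ r + ∑ j ∈ Finset.range r, c j * Q ^ j
  natDegree : P.natDegree = r * Q.natDegree
  value : F P = r • (γ : WithTop Γ)
  le : ∀ j < r, r • (γ : WithTop Γ) ≤ μ (c j) + j • (γ : WithTop Γ)

theorem hasMonicExpansion_of_coeff_eq_one (hT : IsTruncation μ F Q γ) {P : K[X]} {r : ℕ}
    {c : ℕ → K[X]} (hc : ∀ j, (c j).degree < Q.degree)
    (hPc : P = ∑ j ∈ Finset.range (r + 1), c j * Q ^ j) (hr : c r = 1)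
    (hv : F P = μ (c r) + r • (γ : WithTop Γ)) : HasMonicExpansion μ F Q P γ r c where
  degree_lt := hc
  eq := by rw [hPc, Finset.sum_range_succ, hr, one_mul, add_comm]
  natDegree := by
    rw [hPc, (natDegree_sum_eq hT.monic hc (by simp [hr])).1, hr]
    simp
  value := by rw [hv, hr, μ.map_one, zero_add]
  le j hj := by
    have := hT.map_le hc (m := r) (show j < r + 1 by omega)
    rwa [← hPc, hv, hr, μ.map_one, zero_add] at this

theorem IsTruncation.exists_expansion_leading (hT : IsTruncation μ F Q γ) {P : K[X]} (hP : P ≠ 0) :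
    ∃ (r : ℕ) (c : ℕ → K[X]), (∀ j, (c j).degree < Q.degree) ∧
      P = ∑ j ∈ Finset.range (r + 1), c j * Q ^ j ∧ c r ≠ 0 := by
  obtain ⟨c, hc, hPc⟩ := Vaquie.exists_expansion hT.monic (P.natDegree / Q.natDegree) P (by
    rw [mul_comm]; exact Nat.lt_mul_div_succ _ hT.natDegree_pos)
  set r := P.natDegree / Q.natDegree
  refine ⟨r, c, hc, hPc, fun h0 => ?_⟩
  have h1 : P.degree < ((r * Q.natDegree : ℕ) : WithBot ℕ) := by
    conv_lhs => rw [hPc, Finset.sum_range_succ, h0, zero_mul, add_zero]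
    exact degree_sum_lt hT.monic hc r
  rw [degree_eq_natDegree hP] at h1
  have h2 : P.natDegree < r * Q.natDegree := by exact_mod_cast h1
  exact absurd (Nat.div_mul_le_self P.natDegree Q.natDegree) (not_le.2 h2)

/-- A monic polynomial of minimal degree among those whose value is not computed by the truncation
has a monic expansion. -/
theorem IsTruncation.exists_hasMonicExpansion (hμ : TrivialSupport μ) (hT : IsTruncation μ F Q γ)
    (hcarry : ∀ a b q d : K[X], a ≠ 0 → b ≠ 0 → a.degree < Q.degree → b.degree < Q.degree →
      q.degree < Q.degree → d.degree < Q.degree → a * b = q * Q + d →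
      μ a + μ b < μ q + (γ : WithTop Γ))
    {P : K[X]} (hP : P.Monic) (hlt : F P < μ P)
    (hmin : ∀ f : K[X], f.degree < P.degree → F f = μ f) :
    ∃ r c, HasMonicExpansion μ F Q P γ r c := by
  obtain ⟨r, c, hc, hPc, hr⟩ := hT.exists_expansion_leading hP.ne_zero
  -- the largest index at which the minimum of the values of the terms is attained
  obtain ⟨j₀, hj₀, hj₀v⟩ := hT.exists_map_eq (m := r) hc
  rw [← hPc] at hj₀v
  have hle' : ∀ j < r + 1, F P ≤ μ (c j) + j • (γ : WithTop Γ) := fun j hj => by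
    conv_lhs => rw [hPc]
    exact hT.map_le hc hj
  classical
  set δ := Nat.findGreatest (fun j => F P = μ (c j) + j • (γ : WithTop Γ)) r
  have hδ : F P = μ (c δ) + δ • (γ : WithTop Γ) :=
    Nat.findGreatest_spec (P := fun j => F P = μ (c j) + j • (γ : WithTop Γ))
      (Nat.lt_succ_iff.1 hj₀) hj₀v
  obtain ⟨h1, h2⟩ := leading_coeff_eq_one_of_minimal hμ hT hP hc hPc hr
    (Nat.findGreatest_le r) {0} (fun j hj hjr e he => by
      rw [Set.mem_singleton_iff.1 he, WithTop.coe_zero, add_zero]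
      exact lt_of_le_of_ne (hle' j (by omega)) (Nat.findGreatest_is_greatest hj hjr))
    (fun a b q d ha hb hac hbc hqc hdc habq e he => by
      rw [Set.mem_singleton_iff.1 he, WithTop.coe_zero, add_zero]
      exact hcarry a b q d ha hb hac hbc hqc hdc habq)
    (fun q f hq hqc he => by
      by_contra! hf
      have hlt' := he 0 rfl
      rw [WithTop.coe_zero, add_zero, add_comm] at hlt'
      have hqP : F (q * P) = μ q + F P := by rw [F.map_mul, hT.eq_of_degree_lt q hqc]
      rw [← hqP] at hlt'
      have hFf : F f = F (q * P) := F.map_eq_of_lt_sub hlt'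
      have hμq : μ q ≠ ⊤ := fun h => hq (hμ q h)
      have h4 : F f < μ (q * P) := by
        rw [hFf, hqP, μ.map_mul]
        exact (WithTop.add_lt_add_iff_left hμq).2 hlt
      have h5 : F f < μ (f - q * P) := by
        rw [hFf]
        exact hlt'.trans_le (hT.le _)
      have h6 : F f < μ f := by
        have := μ.map_lt_add h5 h4
        rwa [sub_add_cancel] at this
      exact h6.ne (hmin f hf))
  refine ⟨r, c, hasMonicExpansion_of_coeff_eq_one hT hc hPc h2 ?_⟩
  have h3 : δ = r := h1
  rw [← h3]
  exact hδ

end Leading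

end Vaquie

namespace Vaquie

/-! ### Values which are torsion over the value group of `ν` -/

section Torsion

variable {K : Type*} [Field K] {Γ : Type*} [AddCommGroup Γ] [LinearOrder Γ] [IsOrderedAddMonoid Γ]
variable {ν : AddValuation K (WithTop Γ)}

/-- `γ` is torsion modulo the value group of `ν`: some positive multiple is a value of `ν`. -/
def IsTorsionOver (ν : AddValuation K (WithTop Γ)) (γ : Γ) : Prop :=
  ∃ N : ℕ, 0 < N ∧ ∃ c : K, c ≠ 0 ∧ ν c = ((N • γ : Γ) : WithTop Γ)

theorem IsTorsionOver.zero : IsTorsionOver ν 0 :=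
  ⟨1, one_pos, 1, one_ne_zero, by simp [ν.map_one]⟩

theorem IsTorsionOver.of_map_eq {c : K} (hc : c ≠ 0) {γ : Γ} (h : ν c = (γ : WithTop Γ)) :
    IsTorsionOver ν γ :=
  ⟨1, one_pos, c, hc, by rw [h, one_nsmul]⟩

theorem IsTorsionOver.add {a b : Γ} (ha : IsTorsionOver ν a) (hb : IsTorsionOver ν b) :
    IsTorsionOver ν (a + b) := by
  obtain ⟨M, hM, c, hc, hc'⟩ := ha
  obtain ⟨N, hN, d, hd, hd'⟩ := hb
  refine ⟨M * N, Nat.mul_pos hM hN, c ^ N * d ^ M, mul_ne_zero (pow_ne_zero _ hc)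
    (pow_ne_zero _ hd), ?_⟩
  rw [ν.map_mul, ν.map_pow, ν.map_pow, hc', hd', ← WithTop.coe_nsmul, ← WithTop.coe_nsmul,
    ← WithTop.coe_add, nsmul_add, ← mul_nsmul, ← mul_nsmul, mul_comm N M]

theorem IsTorsionOver.neg {a : Γ} (ha : IsTorsionOver ν a) : IsTorsionOver ν (-a) := by
  obtain ⟨M, hM, c, hc, hc'⟩ := ha
  refine ⟨M, hM, c⁻¹, inv_ne_zero hc, ?_⟩
  have h : ν c + ν c⁻¹ = 0 := by rw [← ν.map_mul, mul_inv_cancel₀ hc, ν.map_one]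
  have h' : ν c + ((M • (-a) : Γ) : WithTop Γ) = 0 := by
    rw [hc', ← WithTop.coe_add, ← nsmul_add, add_neg_cancel, nsmul_zero, WithTop.coe_zero]
  refine WithTop.add_left_cancel (x := ν c) ?_ (h.trans h'.symm)
  rw [hc']
  exact WithTop.coe_ne_top

theorem IsTorsionOver.sub {a b : Γ} (ha : IsTorsionOver ν a) (hb : IsTorsionOver ν b) :
    IsTorsionOver ν (a - b) := by
  rw [sub_eq_add_neg]
  exact ha.add hb.neg

theorem IsTorsionOver.nsmul {a : Γ} (ha : IsTorsionOver ν a) (n : ℕ) :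
    IsTorsionOver ν (n • a) := by
  induction n with
  | zero => simpa using IsTorsionOver.zero
  | succ n ih => rw [succ_nsmul]; exact ih.add ha

theorem IsTorsionOver.of_nsmul {a : Γ} {n : ℕ} (hn : 0 < n) (ha : IsTorsionOver ν (n • a)) :
    IsTorsionOver ν a := by
  obtain ⟨M, hM, c, hc, hc'⟩ := ha
  exact ⟨n * M, Nat.mul_pos hn hM, c, hc, by rw [hc', mul_nsmul]⟩

/-- When `ν` has rank one, the group of its torsion values is archimedean. -/
theorem RankOne.exists_le_nsmul (hν : RankOne ν) {u b : Γ} (hu : IsTorsionOver ν u)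
    (hb : IsTorsionOver ν b) (hpos : 0 < u) : ∃ n : ℕ, b ≤ n • u := by
  rcases le_or_gt b 0 with hb0 | hb0
  · exact ⟨0, by simpa using hb0⟩
  obtain ⟨M, hM, c, hc, hc'⟩ := hu
  obtain ⟨N, hN, d, hd, hd'⟩ := hb
  obtain ⟨n, hn⟩ := hν.2 c d hc hd (by
    rw [hc', ← WithTop.coe_zero]
    exact WithTop.coe_lt_coe.2 (nsmul_pos hpos hM.ne'))
  rw [hc', hd', ← WithTop.coe_nsmul, WithTop.coe_le_coe] at hn
  refine ⟨M * n, ?_⟩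
  rw [mul_nsmul]
  refine le_trans ?_ hn
  simpa using nsmul_le_nsmul_left hb0.le (show 1 ≤ N from hN)

/-- The value of `f` is torsion over the value group of `ν`, unless it is infinite. -/
def HasTorsionValue (ν : AddValuation K (WithTop Γ)) (w : AddValuation K[X] (WithTop Γ))
    (f : K[X]) : Prop :=
  ∀ γ : Γ, w f = (γ : WithTop Γ) → IsTorsionOver ν γ

variable {μ F : AddValuation K[X] (WithTop Γ)} {Q : K[X]} {γ : Γ}

theorem IsTruncation.hasTorsionValue (hT : IsTruncation μ F Q γ) (hγ : IsTorsionOver ν γ)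
    (h : ∀ f : K[X], f.degree < Q.degree → HasTorsionValue ν μ f) (f : K[X]) :
    HasTorsionValue ν F f := by
  intro a ha
  obtain ⟨n, c, hc, rfl⟩ := hT.exists_expansion f
  obtain ⟨j, -, hj⟩ := hT.exists_map_eq (m := n) hc
  rw [ha, ← WithTop.coe_nsmul] at hj
  obtain ⟨b, hb⟩ := WithTop.ne_top_iff_exists.1 (WithTop.add_ne_top.1 (hj ▸ WithTop.coe_ne_top)).1
  rw [← hb, ← WithTop.coe_add, WithTop.coe_inj] at hj
  rw [hj]
  exact (h _ (hc j) b hb.symm).add (hγ.nsmul j)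

/-- If a truncation fails to compute the value of some `P`, then the minimum of the values of the
terms of the `Q`-expansion of `P` is attained twice, so that `γ` is torsion. -/
theorem IsTruncation.isTorsionOver (hT : IsTruncation μ F Q γ) (hQ : μ Q = F Q)
    (h : ∀ f : K[X], f.degree < Q.degree → HasTorsionValue ν μ f) {P : K[X]} (hP : F P < μ P) :
    IsTorsionOver ν γ := by
  obtain ⟨n, c, hc, hPc⟩ := hT.exists_expansion P
  have hle : ∀ j ∈ Finset.range (n + 1), F P ≤ μ (c j) + j • (γ : WithTop Γ) := fun j hj => by
    conv_lhs => rw [hPc]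
    exact hT.map_le hc (Finset.mem_range.1 hj)
  obtain ⟨i, hi, hi'⟩ := hT.exists_map_eq (m := n) hc
  rw [← hPc] at hi'
  have hterm : ∀ j, μ (c j * Q ^ j) = μ (c j) + j • (γ : WithTop Γ) := fun j => by
    rw [μ.map_mul, μ.map_pow, hQ, hT.value]
  by_cases hex : ∃ j ∈ Finset.range (n + 1), j ≠ i ∧ F P = μ (c j) + j • (γ : WithTop Γ)
  · obtain ⟨j, -, hji, hj'⟩ := hex
    rw [← WithTop.coe_nsmul] at hi' hj'
    obtain ⟨a, ha⟩ := WithTop.ne_top_iff_exists.1 (WithTop.add_ne_top.1 (hi' ▸ hP.ne_top)).1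
    obtain ⟨b, hb⟩ := WithTop.ne_top_iff_exists.1 (WithTop.add_ne_top.1 (hj' ▸ hP.ne_top)).1
    have hab : a + i • γ = b + j • γ := by
      rw [← ha] at hi'
      rw [← hb] at hj'
      exact_mod_cast hi'.symm.trans hj'
    have hat := h _ (hc i) a ha.symm
    have hbt := h _ (hc j) b hb.symm
    rcases lt_or_gt_of_ne hji with hlt | hlt
    · refine IsTorsionOver.of_nsmul (n := i - j) (by omega) ?_
      rw [sub_nsmul _ hlt.le, show i • γ + -(j • γ) = b - a by grind]
      exact hbt.sub hat
    · refine IsTorsionOver.of_nsmul (n := j - i) (by omega) ?_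
      rw [sub_nsmul _ hlt.le, show j • γ + -(i • γ) = a - b by grind]
      exact hat.sub hbt
  · exfalso
    push Not at hex
    have h1 : F P < μ (∑ j ∈ (Finset.range (n + 1)).erase i, c j * Q ^ j) := by
      refine μ.map_lt_sum hP.ne_top fun j hj => ?_
      rw [Finset.mem_erase] at hj
      rw [hterm]
      exact lt_of_le_of_ne (hle j hj.2) (hex j hj.2 hj.1)
    have h2 : c i * Q ^ i = P - ∑ j ∈ (Finset.range (n + 1)).erase i, c j * Q ^ j := by
      rw [eq_sub_iff_add_eq, hPc]
      exact Finset.add_sum_erase _ (fun j => c j * Q ^ j) (Finset.mem_range.2 hi)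
    have h3 := lt_map_sub hP h1
    rw [← h2, hterm, hi'] at h3
    exact lt_irrefl _ h3

end Torsion

end Vaquie

namespace Vaquie

/-! ### Continued families -/

section Continued

variable {K : Type*} [Field K] {Γ : Type*} [AddCommGroup Γ] [LinearOrder Γ] [IsOrderedAddMonoid Γ]
variable {A : Type*} [LinearOrder A]

/-- If the values `g` are torsion and bounded above, then beyond some index `z` they grow by less
than any prescribed fraction of what they have already grown since the index `x`: otherwise they
would grow geometrically. -/
theorem exists_small_growth {ν : AddValuation K (WithTop Γ)} (hν : RankOne ν) {g : A → Γ}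
    (hg : StrictMono g) (hmax : ∀ x : A, ∃ y, x < y) (x : A)
    (ht : ∀ y, x ≤ y → IsTorsionOver ν (g y)) (δ : ℕ) {b : Γ} (hb : IsTorsionOver ν b)
    (hle : ∀ y, x ≤ y → δ • (g y - g x) ≤ b) :
    ∃ z, x < z ∧ ∀ y, z ≤ y → δ • (g y - g z) < g z - g x := by
  by_contra! hcon
  obtain ⟨y₀, hy₀⟩ := hmax x
  set u := g y₀ - g x with hu
  have hupos : 0 < u := sub_pos.2 (hg hy₀)
  have key : ∀ n : ℕ, ∃ y, y₀ ≤ y ∧ n • u ≤ δ • (g y - g x) := by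
    intro n
    induction n with
    | zero => exact ⟨y₀, le_rfl, by rw [zero_nsmul]; exact nsmul_nonneg hupos.le δ⟩
    | succ n ih =>
      obtain ⟨y, hy, hyn⟩ := ih
      obtain ⟨y', hy', h⟩ := hcon y (hy₀.trans_le hy)
      refine ⟨y', hy.trans hy', ?_⟩
      have h1 : u ≤ g y - g x := by
        have := hg.monotone hy
        grind
      rw [succ_nsmul, show g y' - g x = (g y - g x) + (g y' - g y) by abel, nsmul_add]
      exact add_le_add hyn (h1.trans h)
  obtain ⟨n, hn⟩ := hν.exists_le_nsmul ((ht y₀ hy₀.le).sub (ht x le_rfl)) hb hupos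
  obtain ⟨y, hy, h⟩ := key (n + 1)
  have h1 := h.trans (hle y (hy₀.le.trans hy))
  rw [succ_nsmul] at h1
  have : b ≤ n • u := hn
  grind

/-- A family of truncations of `μ` at polynomials `q x` of the same degree, with strictly
increasing values `g x` and without last element. -/
structure IsContinuedFamily (μ : AddValuation K[X] (WithTop Γ))
    (F : A → AddValuation K[X] (WithTop Γ)) (q : A → K[X]) (g : A → Γ) : Prop where
  trunc : ∀ x, IsTruncation μ (F x) (q x) (g x)
  degree_eq : ∀ x y, (q x).degree = (q y).degree
  strictMono : StrictMono g
  exists_gt : ∀ x : A, ∃ y, x < y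

namespace IsContinuedFamily

variable {μ : AddValuation K[X] (WithTop Γ)} {F : A → AddValuation K[X] (WithTop Γ)}
  {q : A → K[X]} {g : A → Γ}

theorem degree_sub_lt (h : IsContinuedFamily μ F q g) (x y : A) :
    (q y - q x).degree < (q x).degree := by
  rw [← h.degree_eq y x]
  exact Polynomial.degree_sub_lt_left (h.degree_eq y x) (h.trunc y).monic.ne_zero
    (by rw [(h.trunc y).monic.leadingCoeff, (h.trunc x).monic.leadingCoeff])

theorem le_map_sub (h : IsContinuedFamily μ F q g) {x y : A} (hxy : x ≤ y) :
    (g x : WithTop Γ) ≤ μ (q y - q x) := by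
  refine μ.map_le_sub ?_ ?_
  · refine le_trans ?_ ((h.trunc y).le _)
    rw [(h.trunc y).value]
    exact WithTop.coe_le_coe.2 (h.strictMono.monotone hxy)
  · rw [← (h.trunc x).value]
    exact (h.trunc x).le _

theorem map_eq (h : IsContinuedFamily μ F q g) {x y : A} (hxy : x ≤ y) :
    F x (q y) = (g x : WithTop Γ) := by
  have := (h.trunc x).map_add_self (h.degree_sub_lt x y)
  rwa [add_sub_cancel, min_eq_left (h.le_map_sub hxy)] at this

/-- The valuations of a continued family increase. -/
theorem mono (h : IsContinuedFamily μ F q g) {x y : A} (hxy : x ≤ y) (f : K[X]) :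
    F x f ≤ F y f := by
  refine (h.trunc x).le_of_le (fun f hf => (h.trunc y).eq_of_degree_lt f (h.degree_eq y x ▸ hf))
    ?_ f
  rw [show q x = q y - (q y - q x) by ring]
  refine (F y).map_le_sub ?_ ?_
  · rw [(h.trunc y).value]
    exact WithTop.coe_le_coe.2 (h.strictMono.monotone hxy)
  · rw [(h.trunc y).eq_of_degree_lt _ (by rw [h.degree_eq y x]; exact h.degree_sub_lt x y)]
    exact h.le_map_sub hxy

/-- `F x` is also the truncation of `μ` at `q y` with the value `g x`, for every `y ≥ x`. -/
theorem map_le (h : IsContinuedFamily μ F q g) {x y : A} (hxy : x ≤ y) {n : ℕ} {c : ℕ → K[X]}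
    (hc : ∀ j, (c j).degree < (q y).degree) {j : ℕ} (hj : j < n + 1) :
    F x (∑ j ∈ Finset.range (n + 1), c j * q y ^ j) ≤ μ (c j) + j • (g x : WithTop Γ) := by
  rcases hxy.eq_or_lt with rfl | hlt
  · exact (h.trunc x).map_le hc hj
  rw [← h.map_eq hxy]
  refine map_sum_le (h.trunc x).le ?_ _ c
    (fun j => (h.trunc x).eq_of_degree_lt _ (h.degree_eq x y ▸ hc j)) hj
  rw [h.map_eq hxy]
  refine lt_of_lt_of_le ?_ ((h.trunc y).le _)
  rw [(h.trunc y).value]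
  exact WithTop.coe_lt_coe.2 (h.strictMono hlt)

theorem exists_map_eq (h : IsContinuedFamily μ F q g) {x y : A} (hxy : x ≤ y) {n : ℕ}
    {c : ℕ → K[X]} (hc : ∀ j, (c j).degree < (q y).degree)
    (hfin : F x (∑ j ∈ Finset.range (n + 1), c j * q y ^ j) ≠ ⊤) : ∃ j < n + 1,
    F x (∑ j ∈ Finset.range (n + 1), c j * q y ^ j) = μ (c j) + j • (g x : WithTop Γ) := by
  by_contra! hne
  refine lt_irrefl _ (lt_map_sum (F x) hfin fun j hj => ?_)
  rw [(h.trunc x).eq_of_degree_lt (c j) (h.degree_eq x y ▸ hc j), h.map_eq hxy]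
  exact lt_of_le_of_ne (h.map_le hxy hc (Finset.mem_range.1 hj)) (hne j (Finset.mem_range.1 hj))

/-- On the `q y`-expansion of `P`, the value of `P` as a function of `g x`, for `x ≤ y`, is a minimum
of affine functions `a + k • g x`; one of them gives the value at `x`. -/
theorem eq_slope_of_expansion (h : IsContinuedFamily μ F q g) {P : K[X]} {φ : A → Γ}
    (hφ : ∀ x, F x P = (φ x : WithTop Γ)) {x y : A} (hxy : x ≤ y) {n : ℕ} {c : ℕ → K[X]}
    (hc : ∀ j, (c j).degree < (q y).degree)
    (hP : P = ∑ j ∈ Finset.range (n + 1), c j * q y ^ j) :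
    ∃ k < n + 1, ∃ a : Γ, μ (c k) = (a : WithTop Γ) ∧ φ x = a + k • g x ∧
      ∀ z ≤ y, φ z ≤ a + k • g z := by
  obtain ⟨k, hk, hkv⟩ := h.exists_map_eq hxy hc (by rw [← hP, hφ]; exact WithTop.coe_ne_top)
  rw [← hP, hφ] at hkv
  obtain ⟨a, ha⟩ := WithTop.ne_top_iff_exists.1
    (WithTop.add_ne_top.1 (hkv ▸ WithTop.coe_ne_top)).1
  refine ⟨k, hk, a, ha.symm, ?_, fun z hz => ?_⟩
  · rw [← ha] at hkv
    exact_mod_cast hkv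
  · have := h.map_le hz hc hk
    rw [← hP, hφ, ← ha] at this
    exact_mod_cast this

/-- As a function of `g x`, the value `F x P` is concave and piecewise linear, with slopes in `ℕ`;
hence it is eventually linear. The eventual slope is an index at which the minimum of the values
of the terms of the `q z`-expansion of `P` is attained. -/
theorem exists_eventual_slope [Nonempty A] (h : IsContinuedFamily μ F q g) {P : K[X]} {φ : A → Γ}
    (hφ : ∀ x, F x P = (φ x : WithTop Γ)) :
    ∃ (δ : ℕ) (y : A), ∀ z, y < z → φ z = φ y + δ • (g z - g y) ∧
      ∀ (n : ℕ) (c : ℕ → K[X]), (∀ j, (c j).degree < (q z).degree) →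
        P = ∑ j ∈ Finset.range (n + 1), c j * q z ^ j →
        δ ≤ n ∧ ∃ a : Γ, μ (c δ) = (a : WithTop Γ) ∧ φ y = a + δ • g y := by
  have hP : ∀ x, ∃ (n : ℕ) (c : ℕ → K[X]), (∀ j, (c j).degree < (q x).degree) ∧
      P = ∑ j ∈ Finset.range (n + 1), c j * q x ^ j := fun x => (h.trunc x).exists_expansion P
  have hex : ∃ d : ℕ, ∃ x y, x < y ∧ φ y - φ x ≤ d • (g y - g x) := by
    obtain ⟨x⟩ := ‹Nonempty A›
    obtain ⟨y, hy⟩ := h.exists_gt x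
    obtain ⟨n, c, hc, hPc⟩ := hP y
    obtain ⟨k, -, a, -, hk, hk'⟩ := h.eq_slope_of_expansion hφ hy.le hc hPc
    refine ⟨k, x, y, hy, ?_⟩
    have := hk' y le_rfl
    rw [nsmul_sub]
    grind
  classical
  -- By concavity the slopes decrease, so the least slope `δ` is the eventual one.
  obtain ⟨δ, ⟨x₀, y₀, hxy, hδ⟩, hmin⟩ : ∃ d : ℕ, (∃ x y, x < y ∧ φ y - φ x ≤ d • (g y - g x)) ∧
      ∀ k : ℕ, (∃ x y, x < y ∧ φ y - φ x ≤ k • (g y - g x)) → d ≤ k :=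
    ⟨Nat.find hex, Nat.find_spec hex, fun k hk => Nat.find_min' hex hk⟩
  have key : ∀ z, y₀ < z → ∀ (n : ℕ) (c : ℕ → K[X]), (∀ j, (c j).degree < (q z).degree) →
      P = ∑ j ∈ Finset.range (n + 1), c j * q z ^ j →
      δ ≤ n ∧ ∃ a : Γ, μ (c δ) = (a : WithTop Γ) ∧ φ y₀ = a + δ • g y₀ ∧
        φ z ≤ a + δ • g z := by
    intro z hz n c hc hPc
    obtain ⟨k, hkn, a, ha, hk, hk'⟩ := h.eq_slope_of_expansion hφ hz.le hc hPc
    have h1 := hk' x₀ (hxy.le.trans hz.le)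
    have h2 := hk' z le_rfl
    have hkδ : k ≤ δ := by
      by_contra! hlt
      have h3 := nsmul_lt_nsmul_left (sub_pos.2 (h.strictMono hxy)) hlt
      rw [nsmul_sub, nsmul_sub] at h3
      rw [nsmul_sub] at hδ
      grind
    have hδk : δ ≤ k := hmin k ⟨y₀, z, hz, by rw [nsmul_sub]; grind⟩
    obtain rfl := le_antisymm hkδ hδk
    exact ⟨by omega, a, ha, hk, h2⟩
  refine ⟨δ, y₀, fun z hz => ⟨le_antisymm ?_ ?_, fun n c hc hPc => ?_⟩⟩
  · obtain ⟨n, c, hc, hPc⟩ := hP z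
    obtain ⟨-, a, -, h1, h2⟩ := key z hz n c hc hPc
    rw [nsmul_sub]
    grind
  · obtain ⟨z', hz'⟩ := h.exists_gt z
    obtain ⟨n, c, hc, hPc⟩ := hP z'
    obtain ⟨k, -, a, -, hk, hk'⟩ := h.eq_slope_of_expansion hφ hz'.le hc hPc
    have h1 := hk' z' le_rfl
    have h2 := hk' y₀ (hz.le.trans hz'.le)
    have hδk : δ ≤ k := hmin k ⟨z, z', hz', by rw [nsmul_sub]; grind⟩
    have h3 := nsmul_le_nsmul_left (sub_nonneg.2 (h.strictMono hz).le) hδk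
    rw [nsmul_sub, nsmul_sub] at h3
    rw [nsmul_sub]
    grind
  · obtain ⟨h1, a, ha, h2, -⟩ := key z hz n c hc hPc
    exact ⟨h1, a, ha, h2⟩

/-- A monic polynomial `P`, of minimal degree among those whose value is computed by no `F x`, has
a monic expansion in `q z` for some `z`, when the values `F x P` are bounded in the value group of
a valuation `ν` of rank one over which the values of the family are torsion. -/
theorem exists_hasMonicExpansion {ν : AddValuation K (WithTop Γ)} (hν : RankOne ν)
    (hμ : TrivialSupport μ) [Nonempty A] (h : IsContinuedFamily μ F q g) (x₀ : A)
    (hg : ∀ x, x₀ ≤ x → IsTorsionOver ν (g x))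
    (hF : ∀ x, x₀ ≤ x → ∀ f, HasTorsionValue ν (F x) f)
    {P : K[X]} (hP : P.Monic) (hlt : ∀ x, F x P < μ P)
    (hmin : ∀ f : K[X], f.degree < P.degree → ∃ x, ∀ y, x ≤ y → F y f = μ f)
    {b : K} (hb : b ≠ 0) (hbd : ∀ x, F x P ≤ ν b) :
    ∃ z r c, HasMonicExpansion μ (F z) (q z) P (g z) r c := by
  have hfin : ∀ f : K[X], f ≠ 0 → μ f ≠ ⊤ := fun f hf h => hf (hμ f h)
  choose φ hφ' using fun x => WithTop.ne_top_iff_exists.1 (hlt x).ne_top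
  have hφ : ∀ x, F x P = (φ x : WithTop Γ) := fun x => (hφ' x).symm
  obtain ⟨β, hβ⟩ := WithTop.ne_top_iff_exists.1 (ν.ne_top_iff.2 hb)
  obtain ⟨δ, y₀, hslope⟩ := h.exists_eventual_slope hφ
  obtain ⟨y₁, hy₁⟩ := h.exists_gt y₀
  obtain ⟨y, hy₀, hx₀⟩ : ∃ y, y₀ < y ∧ x₀ ≤ y :=
    ⟨max y₁ x₀, hy₁.trans_le (le_max_left _ _), le_max_right _ _⟩
  have hlin : ∀ w, y ≤ w → φ w = φ y + δ • (g w - g y) := fun w hw => by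
    have h1 := (hslope w (hy₀.trans_le hw)).1
    have h2 := (hslope y hy₀).1
    rw [nsmul_sub] at *
    grind
  -- Beyond `z`, the value of `P` grows by less than `g z - g y`; the errors in the `q z`-expansion
  -- of `P` exceed the value of `P` by at least that, because they are bounded by `F y`.
  obtain ⟨z, hyz, hz⟩ := exists_small_growth hν h.strictMono h.exists_gt y
    (fun w hw => hg w (hx₀.trans hw)) δ
    ((IsTorsionOver.of_map_eq hb hβ.symm).sub (hF y hx₀ P _ (hφ y))) (fun w hw => by
      have h1 := hlin w hw
      have h2 := hbd w
      rw [hφ, ← hβ, WithTop.coe_le_coe] at h2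
      rw [← sub_eq_iff_eq_add'] at h1
      rw [← h1]
      exact sub_le_sub_right h2 _)
  obtain ⟨r, c, hc, hPc, hr⟩ := (h.trunc z).exists_expansion_leading hP.ne_zero
  obtain ⟨hδr, a, ha, hφa⟩ := (hslope z (hy₀.trans hyz)).2 r c hc hPc
  have hφz : φ z = a + δ • g z := by
    have h1 := (hslope z (hy₀.trans hyz)).1
    rw [nsmul_sub] at h1
    grind
  have hFz : F z P = μ (c δ) + δ • (g z : WithTop Γ) := by
    rw [hφ, ha, hφz]
    rfl
  have hgz : g y < g z := h.strictMono hyz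
  -- beyond `z`, the value of `P` grows by the elements of this set
  set E : Set Γ := {e | ∃ w, z ≤ w ∧ e = δ • (g w - g z)}
  have hlead : δ = r ∧ c r = 1 := by
    refine leading_coeff_eq_one_of_minimal hμ (h.trunc z) hP hc hPc hr hδr E ?_ ?_ ?_
    · rintro j hj hjr e ⟨w, hw, rfl⟩
      have h1 := h.map_le hyz.le hc (n := r) (j := j) (by omega)
      rw [← hPc, hφ] at h1
      rw [hφ, ← WithTop.coe_add]
      by_cases htop : μ (c j) = ⊤
      · rw [htop, top_add]
        exact WithTop.coe_lt_top _
      obtain ⟨d, hd⟩ := WithTop.ne_top_iff_exists.1 htop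
      rw [← hd] at h1 ⊢
      rw [← WithTop.coe_nsmul, ← WithTop.coe_add, WithTop.coe_le_coe] at h1
      rw [← WithTop.coe_nsmul, ← WithTop.coe_add, WithTop.coe_lt_coe]
      have h2 := nsmul_le_nsmul_left (sub_nonneg.2 hgz.le) (show δ + 1 ≤ j from hj)
      have h3 := hz w hw
      have h4 := hlin z hyz.le
      rw [succ_nsmul] at h2
      rw [nsmul_sub, nsmul_sub] at h2
      rw [nsmul_sub] at h3 h4 ⊢
      grind
    · rintro a b u d ha0 hb0 hac hbc huc hdc hab e ⟨w, hw, rfl⟩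
      have hF' : ∀ f : K[X], f.degree < (q z).degree → F y f = μ f := fun f hf =>
        (h.trunc y).eq_of_degree_lt f (h.degree_eq y z ▸ hf)
      have h1 := map_mul_add_le (h.trunc y).le (Q := q z) (q := u) (hF' d hdc) (by
        rw [h.map_eq hyz.le]
        refine lt_of_lt_of_le (WithTop.coe_lt_coe.2 hgz) ?_
        rw [← (h.trunc z).value]
        exact (h.trunc z).le _)
      rw [← hab, (F y).map_mul, (F y).map_mul, hF' a hac, hF' b hbc, hF' u huc,
        h.map_eq hyz.le] at h1
      obtain ⟨a', ha'⟩ := WithTop.ne_top_iff_exists.1 (hfin a ha0)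
      obtain ⟨b', hb'⟩ := WithTop.ne_top_iff_exists.1 (hfin b hb0)
      rw [← ha', ← hb'] at h1 ⊢
      rw [← WithTop.coe_add] at h1 ⊢
      rw [← WithTop.coe_add]
      by_cases htop : μ u = ⊤
      · rw [htop, top_add]
        exact WithTop.coe_lt_top _
      obtain ⟨u', hu'⟩ := WithTop.ne_top_iff_exists.1 htop
      rw [← hu', ← WithTop.coe_add] at h1 ⊢
      rw [WithTop.coe_le_coe] at h1
      rw [WithTop.coe_lt_coe]
      have h3 := hz w hw
      rw [nsmul_sub] at h3 ⊢
      grind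
    · intro u f hu huc he
      by_contra! hf
      obtain ⟨x, hx⟩ := hmin f hf
      obtain ⟨w, hzw, hxw⟩ : ∃ w, z ≤ w ∧ x ≤ w := ⟨max z x, le_max_left _ _, le_max_right _ _⟩
      have h1 := he _ ⟨w, hzw, rfl⟩
      have h2 : F z P + μ u + ((δ • (g w - g z) : Γ) : WithTop Γ) = F w (u * P) := by
        have h3 : φ w = φ z + δ • (g w - g z) := by
          have h4 := hlin z hyz.le
          have h5 := hlin w (hyz.le.trans hzw)
          rw [nsmul_sub] at *
          grind
        rw [(F w).map_mul, hφ w, h3, (h.trunc w).eq_of_degree_lt u (h.degree_eq w z ▸ huc), hφ z,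
          WithTop.coe_add]
        abel
      rw [h2] at h1
      have h3 : F w (u * P) < F w (f - u * P) := h1.trans_le (h.mono hzw _)
      have h4 : F w f = F w (u * P) := (F w).map_eq_of_lt_sub h3
      have h5 : F w (u * P) < μ (u * P) := by
        rw [(F w).map_mul, μ.map_mul, (h.trunc w).eq_of_degree_lt u (h.degree_eq w z ▸ huc)]
        exact (WithTop.add_lt_add_iff_left (hfin u hu)).2 (hlt w)
      have h6 := μ.map_lt_add (h3.trans_le ((h.trunc w).le _)) h5
      rw [sub_add_cancel, ← h4, hx w hxw] at h6
      exact lt_irrefl _ h6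
  refine ⟨z, r, c, hasMonicExpansion_of_coeff_eq_one (h.trunc z) hc hPc hlead.2 ?_⟩
  rw [← hlead.1]
  exact hFz

end IsContinuedFamily

end Continued

end Vaquie

namespace Vaquie

/-! ### The order of the index set -/

namespace Shape

variable {s : Shape}

/-- The number of the block to which an index belongs. -/
def blockOf (i : s.Idx) : ℕ := (ofLex i).1.1

@[simp] theorem blockOf_b {t : ℕ} (ht : (t : ℕ∞) < s.N) (k : ℕ) (hk : (k : ℕ∞) < s.len t) :
    blockOf (s.b ht k hk) = t := rfl

theorem idx_lt_idx_of_lt {t u : ℕ} (ht : (t : ℕ∞) < s.N) (hu : (u : ℕ∞) < s.N) (h : t < u)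
    (i : s.Block t) (j : s.Block u) : s.idx ht i < s.idx hu j :=
  Sigma.Lex.lt_def.2 (Or.inl h)

theorem lt_of_blockOf_lt {i j : s.Idx} (h : blockOf i < blockOf j) : i < j :=
  Sigma.Lex.lt_def.2 (Or.inl h)

theorem blockOf_le {i j : s.Idx} (h : i ≤ j) : blockOf i ≤ blockOf j := by
  by_contra! h'
  exact absurd (lt_of_blockOf_lt h') (not_lt.2 h)

theorem idx_lt_idx_iff {t : ℕ} (ht : (t : ℕ∞) < s.N) {i j : s.Block t} :
    s.idx ht i < s.idx ht j ↔ i < j := by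
  rw [Sigma.Lex.lt_def]
  constructor
  · rintro (h | ⟨h, h'⟩)
    · exact absurd h (lt_irrefl _)
    · exact h'
  · exact fun h => Or.inr ⟨rfl, h⟩

@[simp] theorem b_lt_b_iff {t : ℕ} (ht : (t : ℕ∞) < s.N) {k l : ℕ} {hk : (k : ℕ∞) < s.len t}
    {hl : (l : ℕ∞) < s.len t} : s.b ht k hk < s.b ht l hl ↔ k < l := by
  rw [b, b, idx_lt_idx_iff]
  exact Sum.Lex.inl_lt_inl_iff.trans Subtype.mk_lt_mk

theorem b_lt_a {t : ℕ} (ht : (t : ℕ∞) < s.N) {k : ℕ} (hk : (k : ℕ∞) < s.len t) (x : s.A t) :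
    s.b ht k hk < s.a ht x := by
  rw [a, b, idx_lt_idx_iff]
  exact Sum.Lex.inl_lt_inr _ _

theorem b_inj {t u : ℕ} {ht : (t : ℕ∞) < s.N} {hu : (u : ℕ∞) < s.N} {k l : ℕ}
    {hk : (k : ℕ∞) < s.len t} {hl : (l : ℕ∞) < s.len u} (h : s.b ht k hk = s.b hu l hl) :
    t = u ∧ k = l := by
  obtain rfl : t = u := congrArg blockOf h
  refine ⟨rfl, ?_⟩
  rcases lt_trichotomy k l with h' | h' | h'
  · exact absurd h ((b_lt_b_iff ht).2 h').ne
  · exact h'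
  · exact absurd h ((b_lt_b_iff ht).2 h').ne'

theorem a_ne_b {t u : ℕ} {ht : (t : ℕ∞) < s.N} {hu : (u : ℕ∞) < s.N} {x : s.A t} {l : ℕ}
    {hl : (l : ℕ∞) < s.len u} : s.a ht x ≠ s.b hu l hl := by
  intro h
  obtain rfl : t = u := congrArg blockOf h
  exact (b_lt_a ht hl x).ne' h

theorem eq_b_or_eq_a (i : s.Idx) :
    (∃ (t : ℕ) (ht : (t : ℕ∞) < s.N) (k : ℕ) (hk : (k : ℕ∞) < s.len t), i = s.b ht k hk) ∨
    ∃ (t : ℕ) (ht : (t : ℕ∞) < s.N) (x : s.A t), i = s.a ht x := by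
  obtain ⟨⟨t, ht⟩, ⟨k, hk⟩ | x⟩ := i
  · exact Or.inl ⟨t, ht, k, hk, rfl⟩
  · exact Or.inr ⟨t, ht, x, rfl⟩

theorem inl_covBy {t : ℕ} {k : ℕ} (hk : (k : ℕ∞) < s.len t)
    (hk' : ((k + 1 : ℕ) : ℕ∞) < s.len t) :
    (Sum.inlₗ ⟨k, hk⟩ : s.Block t) ⋖ Sum.inlₗ ⟨k + 1, hk'⟩ := by
  refine ⟨Sum.Lex.inl_lt_inl_iff.2 (Subtype.mk_lt_mk.2 (Nat.lt_succ_self k)), ?_⟩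
  rintro (⟨l, hl⟩ | x) h1 h2
  · have h1' : (⟨k, hk⟩ : {k : ℕ // (k : ℕ∞) < s.len t}) < ⟨l, hl⟩ :=
      Sum.lex_inl_inl.1 h1
    have h2' : (⟨l, hl⟩ : {k : ℕ // (k : ℕ∞) < s.len t}) < ⟨k + 1, hk'⟩ :=
      Sum.lex_inl_inl.1 h2
    rw [Subtype.mk_lt_mk] at h1' h2'
    omega
  · exact Sum.Lex.not_inr_lt_inl h2

theorem isMin_b_zero (ht : ((0 : ℕ) : ℕ∞) < s.N) (h0 : ((0 : ℕ) : ℕ∞) < s.len 0) :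
    IsMin (s.b ht 0 h0) := by
  rw [isMin_iff_forall_not_lt]
  intro i hi
  have h1 := blockOf_le hi.le
  rcases eq_b_or_eq_a i with ⟨t, ht', k, hk, rfl⟩ | ⟨t, ht', x, rfl⟩
  · obtain rfl : t = 0 := Nat.le_zero.1 h1
    exact Nat.not_lt_zero _ ((b_lt_b_iff ht').1 hi)
  · obtain rfl : t = 0 := Nat.le_zero.1 h1
    exact absurd hi (b_lt_a ht' h0 x).not_gt

theorem InTail.blockOf_eq {t : ℕ} {j : s.Idx} (h : s.InTail t j) : blockOf j = t := by
  obtain ⟨-, ht, ⟨x, rfl⟩ | ⟨k, hk, -, rfl⟩⟩ := h <;> rfl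

theorem inTail_a {t : ℕ} (ht : (t : ℕ∞) < s.N) (x : s.A t) : s.InTail t (s.a ht x) :=
  ⟨⟨x⟩, ht, Or.inl ⟨x, rfl⟩⟩

/-- The last element of `B^(t)` is the least index of the tail. -/
theorem InTail.b_le {t : ℕ} {j : s.Idx} (h : s.InTail t j) {ht : (t : ℕ∞) < s.N} {n : ℕ}
    {hn : (n : ℕ∞) < s.len t} : s.b ht n hn ≤ j := by
  obtain ⟨-, ht', ⟨x, rfl⟩ | ⟨k, hk, hk', rfl⟩⟩ := h
  · exact (b_lt_a ht hn x).le
  · rw [← not_lt, b_lt_b_iff, not_lt]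
    rw [← hk'] at hn
    have : n < k + 1 := by exact_mod_cast hn
    omega

end Shape

end Vaquie

namespace Vaquie

/-! ### Admitted families as truncations -/

section Augmented

variable {K : Type*} [Field K] {Γ : Type*} [AddCommGroup Γ] [LinearOrder Γ] [IsOrderedAddMonoid Γ]
variable {μ v F : AddValuation K[X] (WithTop Γ)} {Q : K[X]} {γ : Γ}

namespace IsTruncation

theorem le_map_self (hT : IsTruncation μ F Q γ) : (γ : WithTop Γ) ≤ μ Q := by
  rw [← hT.value]
  exact hT.le Q

theorem degree_sub_lt (hT : IsTruncation μ F Q γ) {φ : K[X]} (hφ : φ.Monic)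
    (hdeg : φ.degree = Q.degree) : (φ - Q).degree < Q.degree := by
  rw [← hdeg]
  exact degree_sub_lt_left hdeg hφ.ne_zero (by rw [hφ.leadingCoeff, hT.monic.leadingCoeff])

theorem map_eq_of_le (hT : IsTruncation μ F Q γ) {φ : K[X]} (hφ : φ.Monic)
    (hdeg : φ.degree = Q.degree) (h : (γ : WithTop Γ) ≤ μ φ) : F φ = (γ : WithTop Γ) := by
  have := hT.map_add_self (hT.degree_sub_lt hφ hdeg)
  rwa [add_sub_cancel, min_eq_left (μ.map_le_sub h hT.le_map_self)] at this

/-- A truncation cannot be wrong on a monic polynomial of degree `deg Q` unless it gives it the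
value of `Q`. -/
theorem map_eq_of_lt (hT : IsTruncation μ F Q γ) {φ : K[X]} (hφ : φ.Monic)
    (hdeg : φ.degree = Q.degree) (h : F φ < μ φ) : F φ = (γ : WithTop Γ) := by
  have h1 := hT.map_add_self (hT.degree_sub_lt hφ hdeg)
  rw [add_sub_cancel] at h1
  by_contra hne
  have hlt : μ (φ - Q) < (γ : WithTop Γ) := by
    by_contra! h2
    exact hne (by rw [h1, min_eq_left h2])
  rw [min_eq_right hlt.le] at h1
  have h2 := μ.map_add_eq_of_lt_left (hlt.trans_le hT.le_map_self)
  rw [sub_add_cancel] at h2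
  exact h.ne (h1.trans h2.symm)

end IsTruncation

theorem natDegree_pos_of_map_ne {v w : AddValuation K[X] (WithTop Γ)} (hQ : Q.Monic)
    (h : v Q ≠ w Q) : 0 < Q.natDegree := by
  refine Nat.pos_of_ne_zero fun h0 => h ?_
  rw [hQ.natDegree_eq_zero.1 h0, v.map_one, w.map_one]

theorem IsAugmentedWith.map_eq (h : IsAugmentedWith v Q γ F) {f : K[X]} (hf : f.degree < Q.degree) :
    F f = v f := by
  simpa using h.expansion 0 (fun _ => f) fun _ => hf

theorem IsAugmented.map_eq (h : IsAugmented v Q F) {f : K[X]} (hf : f.degree < Q.degree) :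
    F f = v f :=
  h.elim fun _ h => h.map_eq hf

theorem IsAugmented.lt (h : IsAugmented v Q F) : v Q < F Q := by
  obtain ⟨γ, h⟩ := h
  rw [h.value]
  exact h.lt

theorem IsAugmented.exists_isTruncation (h : IsAugmented v Q F) (hle : ∀ f, F f ≤ μ f)
    (heq : ∀ f : K[X], f.degree < Q.degree → F f = μ f) : ∃ γ : Γ, IsTruncation μ F Q γ := by
  have hlt := h.lt
  obtain ⟨γ, h⟩ := h
  refine ⟨γ, h.key.monic, natDegree_pos_of_map_ne h.key.monic hlt.ne, hle, heq, h.value,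
    fun m c hc => ?_⟩
  rw [h.expansion m c hc]
  refine Finset.inf_congr rfl fun j _ => ?_
  rw [← heq _ (hc j), h.map_eq (hc j)]

theorem IsFirstAugmented.exists_isTruncation {ν : AddValuation K (WithTop Γ)}
    (h : IsFirstAugmented ν Q F) (hle : ∀ f, F f ≤ μ f)
    (heq : ∀ f : K[X], f.degree < Q.degree → F f = μ f) (hμν : ∀ c : K, μ (C c) = ν c) :
    ∃ γ : Γ, IsTruncation μ F Q γ := by
  obtain ⟨hmonic, hdeg, γ, hγ, hexp⟩ := h
  refine ⟨γ, hmonic, by omega, hle, heq, hγ, fun m c hc => ?_⟩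
  have hC : ∀ j, c j = C ((c j).coeff 0) := fun j => by
    refine eq_C_of_natDegree_eq_zero ?_
    by_cases h0 : c j = 0
    · simp [h0]
    · have := natDegree_lt_natDegree h0 (hc j)
      omega
  have h1 := hexp m fun j => (c j).coeff 0
  simp only [← hC, ← hμν] at h1
  exact h1

section Limit

variable {A : Type*} [LinearOrder A] {G : A → AddValuation K[X] (WithTop Γ)}

theorem IsLimitAugmented.isStableValue (h : IsLimitAugmented G Q F) {f : K[X]}
    (hf : f.degree < Q.degree) : IsStableValue G f (F f) := by
  obtain ⟨-, γ, -, -, hexp⟩ := h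
  obtain ⟨w, hw, hw'⟩ := hexp 0 (fun _ => f) fun _ => hf
  have h1 : F f = w 0 := by simpa using hw'
  rw [h1]
  exact hw 0 le_rfl

theorem IsLimitAugmented.lt (h : IsLimitAugmented G Q F) (x : A) : G x Q < F Q := by
  obtain ⟨-, γ, hγ, hγ', -⟩ := h
  rw [hγ']
  exact hγ x

theorem IsStableValue.unique {f : K[X]} {w w' : WithTop Γ} (h : IsStableValue G f w)
    (h' : IsStableValue G f w') : w = w' := by
  obtain ⟨x, hx⟩ := h
  obtain ⟨y, hy⟩ := h'
  rw [← hx (max x y) (le_max_left _ _), hy (max x y) (le_max_right _ _)]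

theorem IsLimitAugmented.exists_isTruncation [Nonempty A] (h : IsLimitAugmented G Q F) (hle : ∀ f, F f ≤ μ f)
    (heq : ∀ f : K[X], f.degree < Q.degree → F f = μ f) : ∃ γ : Γ, IsTruncation μ F Q γ := by
  have hlt := h.lt (Classical.arbitrary A)
  have hst := @h.isStableValue
  obtain ⟨hkey, γ, -, hγ, hexp⟩ := h
  refine ⟨γ, hkey.monic, natDegree_pos_of_map_ne hkey.monic hlt.ne, hle, heq, hγ,
    fun m c hc => ?_⟩
  obtain ⟨w, hw, hw'⟩ := hexp m c hc
  rw [hw']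
  refine Finset.inf_congr rfl fun j hj => ?_
  rw [← heq _ (hc j), (hst (hc j)).unique (hw j (Nat.lt_succ_iff.1 (Finset.mem_range.1 hj)))]

end Limit

/-- Carries in a product of two polynomials of small degree exceed the value of the product, if
some valuation `v ≤ μ` which coincides with `μ` in small degrees has `v Q < γ`. -/
theorem add_lt_of_carry (hle : ∀ f, v f ≤ μ f) (hvQ : v Q < (γ : WithTop Γ))
    (hQ : (γ : WithTop Γ) ≤ μ Q) {a b q d : K[X]} (ha : v a = μ a) (hb : v b = μ b)
    (hq : v q = μ q) (hd : v d = μ d) (hab : a * b = q * Q + d) (ha0 : μ a ≠ ⊤) (hb0 : μ b ≠ ⊤) :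
    μ a + μ b < μ q + (γ : WithTop Γ) := by
  have h := map_mul_add_le hle (q := q) hd (hvQ.trans_le hQ)
  rw [← hab, v.map_mul, v.map_mul, ha, hb, hq] at h
  by_cases htop : μ q = ⊤
  · rw [htop, top_add]
    exact lt_top_iff_ne_top.2 (WithTop.add_ne_top.2 ⟨ha0, hb0⟩)
  · exact h.trans_lt ((WithTop.add_lt_add_iff_left htop).2 hvQ)

end Augmented

section Families

variable {K : Type*} [Field K] {Γ : Type*} [AddCommGroup Γ] [LinearOrder Γ] [IsOrderedAddMonoid Γ]
variable {ν : AddValuation K (WithTop Γ)} {μ : AddValuation K[X] (WithTop Γ)}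
variable {s : Shape} {F : s.Idx → AddValuation K[X] (WithTop Γ)} {Q : s.Idx → K[X]}

namespace IsAdmissible

theorem isAugmented_b_succ (hF : IsAdmissible s ν F Q) {t : ℕ} (ht : (t : ℕ∞) < s.N) {k : ℕ}
    (hk : (k : ℕ∞) < s.len t) (hk' : ((k + 1 : ℕ) : ℕ∞) < s.len t) :
    IsAugmented (F (s.b ht k hk)) (Q (s.b ht (k + 1) hk')) (F (s.b ht (k + 1) hk')) := by
  have hcov := Shape.inl_covBy hk hk'
  obtain ⟨θ, -, haug, hpred, -⟩ := (hF.simple t ht).iterated.2 (Sum.inlₗ ⟨k + 1, hk'⟩)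
    (not_isMin_of_lt hcov.lt)
  obtain ⟨rfl, -⟩ := hpred _ hcov
  exact haug

/-- When `A^(t)` is nonempty, `B^(t)` has a last element. -/
theorem exists_last (hF : IsAdmissible s ν F Q) {t : ℕ} (ht : (t : ℕ∞) < s.N) (x : s.A t) :
    ∃ n : ℕ, ((n : ℕ∞) < s.len t) ∧ (n : ℕ∞) + 1 = s.len t := by
  obtain ⟨m, hm⟩ := ENat.ne_top_iff_exists.1 ((hF.simple t ht).len_finite ⟨x⟩).ne
  have hpos := (hF.simple t ht).len_pos
  rw [← hm] at hpos ⊢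
  have : 0 < m := by exact_mod_cast hpos
  obtain ⟨n, rfl⟩ := Nat.exists_eq_succ_of_ne_zero this.ne'
  exact ⟨n, by exact_mod_cast Nat.lt_succ_self n, by push_cast; rfl⟩

/-- For an index of `A^(t)`, an index of which it is an augmentation can be chosen in the tail: when
the one provided by the definition precedes the last element of `B^(t)`, there is no immediate
predecessor, and that last element will do. -/
theorem exists_isAugmented_a (hF : IsAdmissible s ν F Q) {t : ℕ} (ht : (t : ℕ∞) < s.N) (x : s.A t) :
    ∃ j, j < s.a ht x ∧ s.InTail t j ∧ IsAugmented (F j) (Q (s.a ht x)) (F (s.a ht x)) := by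
  obtain ⟨n, hn, hn'⟩ := hF.exists_last ht x
  have hnx : (Sum.inlₗ ⟨n, hn⟩ : s.Block t) < Sum.inrₗ x := Sum.Lex.inl_lt_inr _ _
  obtain ⟨θ, hθ, haug, hpred, hnopred⟩ := (hF.simple t ht).iterated.2 (Sum.inrₗ x)
    (not_isMin_of_lt hnx)
  rcases θ with ⟨k, hk⟩ | y
  · have hkn : k ≤ n := by
      have : (k : ℕ∞) < n + 1 := hn' ▸ hk
      have : k < n + 1 := by exact_mod_cast this
      omega
    rcases hkn.eq_or_lt with rfl | hlt
    · exact ⟨s.b ht k hk, Shape.b_lt_a ht hk x, ⟨⟨x⟩, ht, Or.inr ⟨k, hk, hn', rfl⟩⟩, haug⟩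
    · -- the last element of `B` lies strictly between, so there is no immediate predecessor
      have hkn : (Sum.inlₗ ⟨k, hk⟩ : s.Block t) < Sum.inlₗ ⟨n, hn⟩ :=
        Sum.Lex.inl_lt_inl_iff.2 (Subtype.mk_lt_mk.2 hlt)
      have hno : ¬ ∃ p : s.Block t, p ⋖ Sum.inrₗ x := by
        rintro ⟨p, hp⟩
        obtain ⟨rfl, -⟩ := hpred p hp
        exact hp.2 hkn hnx
      exact ⟨s.b ht n hn, Shape.b_lt_a ht hn x, ⟨⟨x⟩, ht, Or.inr ⟨n, hn, hn', rfl⟩⟩,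
        (hnopred hno _ hkn hnx).2.1⟩
  · exact ⟨s.a ht y, Shape.idx_lt_idx_iff ht |>.2 hθ, Shape.inTail_a ht y, haug⟩

theorem isLimitAugmented (hF : IsAdmissible s ν F Q) {t : ℕ} (ht : (t : ℕ∞) < s.N)
    (ht' : ((t + 1 : ℕ) : ℕ∞) < s.N) (h0 : ((0 : ℕ) : ℕ∞) < s.len (t + 1)) :
    IsLimitAugmented (fun x : s.A t => F (s.a ht x)) (Q (s.b ht' 0 h0)) (F (s.b ht' 0 h0)) :=
  hF.limit t ht ht' h0

theorem lt_N_of_succ {t : ℕ} (ht' : ((t + 1 : ℕ) : ℕ∞) < s.N) : (t : ℕ∞) < s.N :=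
  lt_of_le_of_lt (by exact_mod_cast Nat.le_succ t) ht'

theorem lt_len_of_succ {t k : ℕ} (hk : ((k + 1 : ℕ) : ℕ∞) < s.len t) : (k : ℕ∞) < s.len t :=
  lt_of_le_of_lt (by exact_mod_cast Nat.le_succ k) hk

/-- All the valuations of an admitted family are truncations of `μ` at their key polynomials. -/
theorem exists_isTruncation (hF : IsAdmissible s ν F Q) (hFμ : IsAdmitted s F Q μ)
    (hμν : ∀ c : K, μ (C c) = ν c) (i : s.Idx) : ∃ γ : Γ, IsTruncation μ (F i) (Q i) γ := by
  rcases Shape.eq_b_or_eq_a i with ⟨t, ht, k, hk, rfl⟩ | ⟨t, ht, x, rfl⟩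
  · cases k with
    | zero =>
      cases t with
      | zero => exact (hF.first ht hk).exists_isTruncation (hFμ.le _) (hFμ.eq_of_degree_lt _) hμν
      | succ t =>
        have := hF.nondiscrete t ht
        exact (hF.isLimitAugmented (lt_N_of_succ ht) ht hk).exists_isTruncation (hFμ.le _)
          (hFμ.eq_of_degree_lt _)
    | succ k =>
      exact (hF.isAugmented_b_succ ht (lt_len_of_succ hk) hk).exists_isTruncation (hFμ.le _)
        (hFμ.eq_of_degree_lt _)
  · obtain ⟨j, -, -, h⟩ := hF.exists_isAugmented_a ht x
    exact h.exists_isTruncation (hFμ.le _) (hFμ.eq_of_degree_lt _)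

end IsAdmissible

end Families

end Vaquie

namespace Vaquie

/-! ### Degrees, torsion and expansions of the key polynomials -/

section Families

variable {K : Type*} [Field K] {Γ : Type*} [AddCommGroup Γ] [LinearOrder Γ] [IsOrderedAddMonoid Γ]
variable {ν : AddValuation K (WithTop Γ)} {μ : AddValuation K[X] (WithTop Γ)}
variable {s : Shape} {F : s.Idx → AddValuation K[X] (WithTop Γ)} {Q : s.Idx → K[X]}
variable {g : s.Idx → Γ}

namespace IsAdmissible

theorem degree_b_lt (hF : IsAdmissible s ν F Q) {t : ℕ} (ht : (t : ℕ∞) < s.N) {k l : ℕ}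
    (hkl : k < l) (hk : (k : ℕ∞) < s.len t) (hl : (l : ℕ∞) < s.len t) :
    (Q (s.b ht k hk)).degree < (Q (s.b ht l hl)).degree := by
  induction l with
  | zero => omega
  | succ l ih =>
    have hstep := (hF.simple t ht).degree_lt l (lt_len_of_succ hl) hl
    rcases (Nat.lt_succ_iff.1 hkl).eq_or_lt with rfl | h
    · exact hstep
    · exact (ih h (lt_len_of_succ hl)).trans hstep

theorem degree_eq_of_inTail (hF : IsAdmissible s ν F Q) {t : ℕ} (ht : (t : ℕ∞) < s.N) (x : s.A t)
    {j : s.Idx} (hj : s.InTail t j) : (Q j).degree = (Q (s.a ht x)).degree := by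
  obtain ⟨-, ht', ⟨y, rfl⟩ | ⟨k, hk, hk', rfl⟩⟩ := hj
  · obtain ⟨-, v, -, -, h, -⟩ := (hF.simple t ht).exhaustive ⟨x⟩
    exact h y x
  · exact ((hF.simple t ht).degree_eq x k hk hk').symm

/-- An index of a block with nonempty `A^(t)` either lies in the tail of the block, or its key
polynomial has smaller degree than those of the tail. -/
theorem inTail_or_degree_lt (hF : IsAdmissible s ν F Q) {t : ℕ} (ht : (t : ℕ∞) < s.N) (x : s.A t)
    {j : s.Idx} (hj : Shape.blockOf j = t) :
    s.InTail t j ∨ (Q j).degree < (Q (s.a ht x)).degree := by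
  rcases Shape.eq_b_or_eq_a j with ⟨u, hu, k, hk, rfl⟩ | ⟨u, hu, y, rfl⟩
  · obtain rfl : u = t := hj
    obtain ⟨n, hn, hn'⟩ := hF.exists_last ht x
    have hkn : k ≤ n := by
      have : (k : ℕ∞) < n + 1 := hn' ▸ hk
      have : k < n + 1 := by exact_mod_cast this
      omega
    rcases hkn.eq_or_lt with rfl | hlt
    · exact Or.inl ⟨⟨x⟩, ht, Or.inr ⟨k, hk, hn', rfl⟩⟩
    · refine Or.inr ((hF.degree_b_lt ht hlt hk hn).trans_eq ?_)
      exact ((hF.simple u ht).degree_eq x n hn hn').symm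
  · obtain rfl : u = t := hj
    exact Or.inl (Shape.inTail_a ht y)

end IsAdmissible

theorem IsAdmitted.exists_monic_of_lt (hFμ : IsAdmitted s F Q μ) {t : ℕ} (ht : (t : ℕ∞) < s.N)
    {x y : s.A t} (hxy : x < y) : ∃ φ : K[X], φ.Monic ∧ φ.degree = (Q (s.a ht x)).degree ∧
      F (s.a ht x) φ < μ φ ∧ F (s.a ht y) (Q (s.a ht y)) = μ φ :=
  (hFμ.values t ht x).subset ⟨y, hxy, rfl⟩

theorem IsAdmitted.exists_lt_of_monic (hFμ : IsAdmitted s F Q μ) {t : ℕ} (ht : (t : ℕ∞) < s.N)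
    {x : s.A t} {φ : K[X]} (hφ : φ.Monic) (hdeg : φ.degree = (Q (s.a ht x)).degree)
    (hlt : F (s.a ht x) φ < μ φ) : ∃ y, x < y ∧ μ φ = F (s.a ht y) (Q (s.a ht y)) :=
  (hFμ.values t ht x).superset ⟨φ, hφ, hdeg, hlt, rfl⟩

/-- The part `A^(t)` of a block is a continued family. -/
theorem isContinuedFamily (hF : IsAdmissible s ν F Q) (hFμ : IsAdmitted s F Q μ)
    (hT : ∀ i, IsTruncation μ (F i) (Q i) (g i)) {t : ℕ} (ht : (t : ℕ∞) < s.N) (x₀ : s.A t) :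
    IsContinuedFamily μ (fun x : s.A t => F (s.a ht x)) (fun x => Q (s.a ht x))
      fun x => g (s.a ht x) := by
  have hmono : StrictMono fun x : s.A t => g (s.a ht x) := by
    intro x y hxy
    obtain ⟨φ, hφ, hdeg, hlt, heq⟩ := hFμ.exists_monic_of_lt ht hxy
    rw [(hT _).value] at heq
    rw [(hT _).map_eq_of_lt hφ hdeg hlt, ← heq, WithTop.coe_lt_coe] at hlt
    exact hlt
  refine ⟨fun x => hT _, fun x y => ?_, hmono, fun x => ?_⟩
  · exact hF.degree_eq_of_inTail ht y (Shape.inTail_a ht x)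
  · obtain ⟨-, v, -, -, -, -, -, h, -⟩ := (hF.simple t ht).exhaustive ⟨x₀⟩
    obtain ⟨y, hy⟩ := h x
    rw [(hT _).value, (hT _).value, WithTop.coe_lt_coe] at hy
    exact ⟨y, hmono.lt_iff_lt.1 hy⟩

/-- The key polynomial of a limit index has greater degree than those of the preceding tail. -/
theorem degree_lt_limit (hF : IsAdmissible s ν F Q) (hFμ : IsAdmitted s F Q μ)
    (hT : ∀ i, IsTruncation μ (F i) (Q i) (g i)) {t : ℕ} (ht : (t : ℕ∞) < s.N)
    (ht' : ((t + 1 : ℕ) : ℕ∞) < s.N) (h0 : ((0 : ℕ) : ℕ∞) < s.len (t + 1)) (x : s.A t) :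
    (Q (s.a ht x)).degree < (Q (s.b ht' 0 h0)).degree := by
  have hlt : ∀ y : s.A t, F (s.a ht y) (Q (s.b ht' 0 h0)) < μ (Q (s.b ht' 0 h0)) := fun y =>
    ((hF.isLimitAugmented ht ht' h0).lt y).trans_le (hFμ.le _ _)
  by_contra! hle
  rcases hle.lt_or_eq with h | h
  · exact (hlt x).ne ((hT _).eq_of_degree_lt _ h)
  -- otherwise the value of the limit key polynomial would be reached inside the family
  obtain ⟨y, hxy, hy⟩ := hFμ.exists_lt_of_monic ht (hT (s.b ht' 0 h0)).monic h (hlt x)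
  rw [(hT _).value] at hy
  have h' := h.trans (hF.degree_eq_of_inTail ht y (Shape.inTail_a ht x))
  have h1 := hlt y
  rw [(hT _).map_eq_of_le (hT _).monic h' hy.ge, hy] at h1
  exact lt_irrefl _ h1

theorem degree_lt_of_blockOf_lt (hF : IsAdmissible s ν F Q) (hFμ : IsAdmitted s F Q μ)
    (hT : ∀ i, IsTruncation μ (F i) (Q i) (g i)) {t : ℕ} (ht : (t : ℕ∞) < s.N)
    (h0 : ((0 : ℕ) : ℕ∞) < s.len t) {j : s.Idx} (hj : Shape.blockOf j < t) :
    (Q j).degree < (Q (s.b ht 0 h0)).degree := by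
  induction t with
  | zero => omega
  | succ t ih =>
    have ht' := IsAdmissible.lt_N_of_succ ht
    obtain ⟨x⟩ := hF.nondiscrete t ht
    refine lt_of_le_of_lt ?_ (degree_lt_limit hF hFμ hT ht' ht h0 x)
    have key : ∀ i, Shape.blockOf i = t → (Q i).degree ≤ (Q (s.a ht' x)).degree := fun i hi =>
      (hF.inTail_or_degree_lt ht' x hi).elim (fun h => (hF.degree_eq_of_inTail ht' x h).le)
        fun h => h.le
    rcases (Nat.lt_succ_iff.1 hj).eq_or_lt with h | h
    · exact key j h
    · exact (ih ht' (hF.simple t ht').len_pos h).le.trans (key _ rfl)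

theorem degree_le_of_isPlus (hF : IsAdmissible s ν F Q) (hFμ : IsAdmitted s F Q μ)
    (hT : ∀ i, IsTruncation μ (F i) (Q i) (g i)) {l j i : s.Idx} (h : s.IsPlus l j i) :
    (Q j).degree ≤ (Q i).degree := by
  obtain ⟨-, -, ⟨t, ht, k, hk, hk', rfl, rfl⟩ | ⟨t, ht, x, y, hj, rfl, -⟩ | ⟨t, ht, h0, hj, rfl⟩⟩ := h
  · exact (hF.degree_b_lt ht (Nat.lt_succ_self k) hk hk').le
  · exact (hF.degree_eq_of_inTail ht x hj).le
  · exact (degree_lt_of_blockOf_lt hF hFμ hT ht h0 (by rw [hj.blockOf_eq]; omega)).le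

theorem alpha_pos (hF : IsAdmissible s ν F Q) (hFμ : IsAdmitted s F Q μ)
    (hT : ∀ i, IsTruncation μ (F i) (Q i) (g i)) {l j i : s.Idx} (h : s.IsPlus l j i) :
    0 < alpha Q j i :=
  Nat.div_pos (natDegree_le_natDegree (degree_le_of_isPlus hF hFμ hT h)) (hT j).natDegree_pos

/-- Every valuation of index smaller than a limit index is bounded by one of the valuations of the
preceding tail. -/
theorem exists_le_tail (hF : IsAdmissible s ν F Q) (hFμ : IsAdmitted s F Q μ)
    (hT : ∀ i, IsTruncation μ (F i) (Q i) (g i)) {t : ℕ} (ht : (t : ℕ∞) < s.N)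
    (ht' : ((t + 1 : ℕ) : ℕ∞) < s.N) (h0 : ((0 : ℕ) : ℕ∞) < s.len (t + 1)) {j : s.Idx}
    (hj : j < s.b ht' 0 h0) : ∃ x : s.A t, ∀ f, F j f ≤ F (s.a ht x) f := by
  obtain ⟨x⟩ := hF.nondiscrete t ht'
  have hle : ∀ {y : s.A t}, (Q j).degree ≤ (Q (s.a ht y)).degree →
      (g j : WithTop Γ) ≤ F (s.a ht y) (Q j) → ∀ f, F j f ≤ F (s.a ht y) f := fun hdeg hg =>
    (hT j).le_of_le (fun f hf => (hT _).eq_of_degree_lt f (hf.trans_le hdeg)) hg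
  have hlt : (Q j).degree < (Q (s.a ht x)).degree → ∃ x : s.A t, ∀ f, F j f ≤ F (s.a ht x) f :=
    fun h => ⟨x, hle h.le (by rw [(hT _).eq_of_degree_lt _ h]; exact (hT j).le_map_self)⟩
  have hblock : Shape.blockOf j ≤ t := by
    have h1 := Shape.blockOf_le hj.le
    rw [Shape.blockOf_b] at h1
    by_contra! h2
    have h3 : Shape.blockOf j = t + 1 := by omega
    rcases Shape.eq_b_or_eq_a j with ⟨u, hu, k, hk, rfl⟩ | ⟨u, hu, y, rfl⟩
    · obtain rfl : u = t + 1 := h3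
      exact Nat.not_lt_zero _ ((Shape.b_lt_b_iff hu).1 hj)
    · obtain rfl : u = t + 1 := h3
      exact absurd hj (Shape.b_lt_a hu h0 y).not_gt
  rcases hblock.eq_or_lt with h | h
  · rcases hF.inTail_or_degree_lt ht x h with htail | hdeg
    · have hdeg := hF.degree_eq_of_inTail ht x htail
      by_cases hg : (g j : WithTop Γ) ≤ F (s.a ht x) (Q j)
      · exact ⟨x, hle hdeg.le hg⟩
      -- then `μ (Q j)` is one of the values of the family
      have hlt : F (s.a ht x) (Q j) < μ (Q j) := (not_le.1 hg).trans_le (hT j).le_map_self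
      obtain ⟨y, hxy, hy⟩ := hFμ.exists_lt_of_monic ht (hT j).monic hdeg hlt
      have hdeg' := hF.degree_eq_of_inTail ht y htail
      refine ⟨y, hle hdeg'.le ?_⟩
      rw [(hT _).value] at hy
      rw [(hT _).map_eq_of_le (hT j).monic hdeg' hy.ge, ← hy]
      exact (hT j).le_map_self
    · exact hlt hdeg
  · have h1 := (hF.simple t ht).len_pos
    refine hlt ((degree_lt_of_blockOf_lt hF hFμ hT ht h1 h).trans_le ?_)
    rcases hF.inTail_or_degree_lt ht x (Shape.blockOf_b ht 0 h1) with h2 | h2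
    · exact (hF.degree_eq_of_inTail ht x h2).le
    · exact h2.le

/-- The values of a polynomial of degree less than that of a limit key polynomial are eventually
computed by the preceding tail. -/
theorem exists_forall_ge_map_eq (hF : IsAdmissible s ν F Q) (hFμ : IsAdmitted s F Q μ)
    {t : ℕ} (ht : (t : ℕ∞) < s.N) (ht' : ((t + 1 : ℕ) : ℕ∞) < s.N)
    (h0 : ((0 : ℕ) : ℕ∞) < s.len (t + 1)) {f : K[X]} (hf : f.degree < (Q (s.b ht' 0 h0)).degree) :
    ∃ x : s.A t, ∀ y, x ≤ y → F (s.a ht y) f = μ f := by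
  obtain ⟨x, hx⟩ := (hF.isLimitAugmented ht ht' h0).isStableValue hf
  exact ⟨x, fun y hy => (hx y hy).trans (hFμ.eq_of_degree_lt _ f hf)⟩

/-- Carries in products of two polynomials of degree less than `deg Q_i` exceed the value of the
product. -/
theorem add_lt_of_carry_index (hμ : TrivialSupport μ) (hF : IsAdmissible s ν F Q)
    (hFμ : IsAdmitted s F Q μ) (hT : ∀ i, IsTruncation μ (F i) (Q i) (g i)) (i : s.Idx)
    (a b q d : K[X]) (ha : a ≠ 0) (hb : b ≠ 0) (hac : a.degree < (Q i).degree)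
    (hbc : b.degree < (Q i).degree) (hqc : q.degree < (Q i).degree)
    (hdc : d.degree < (Q i).degree) (hab : a * b = q * Q i + d) :
    μ a + μ b < μ q + (g i : WithTop Γ) := by
  have ha0 : μ a ≠ ⊤ := fun h => ha (hμ a h)
  have hb0 : μ b ≠ ⊤ := fun h => hb (hμ b h)
  have haug : ∀ j, IsAugmented (F j) (Q i) (F i) → μ a + μ b < μ q + (g i : WithTop Γ) := by
    intro j hj
    have heq : ∀ f : K[X], f.degree < (Q i).degree → F j f = μ f := fun f hf =>
      (hj.map_eq hf).symm.trans (hFμ.eq_of_degree_lt i f hf)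
    exact add_lt_of_carry (hFμ.le j) (by rw [← (hT i).value]; exact hj.lt) (hT i).le_map_self
      (heq a hac) (heq b hbc) (heq q hqc) (heq d hdc) hab ha0 hb0
  rcases Shape.eq_b_or_eq_a i with ⟨t, ht, k, hk, rfl⟩ | ⟨t, ht, x, rfl⟩
  · cases k with
    | zero =>
      cases t with
      | zero =>
        have hdeg := (hF.first ht hk).2.1
        have hq : q = 0 := by
          by_contra hq
          have h1 : (q * Q (s.b ht 0 hk) + d).natDegree = q.natDegree + 1 := by
            rw [natDegree_add_eq_left_of_degree_lt, natDegree_mul hq (hT _).monic.ne_zero, hdeg]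
            refine hdc.trans_le ?_
            rw [mul_comm]
            exact degree_le_mul_left _ hq
          have h2 := natDegree_lt_natDegree ha hac
          have h3 := natDegree_lt_natDegree hb hbc
          rw [← hab, natDegree_mul ha hb] at h1
          omega
        rw [hq, μ.map_zero, top_add]
        exact lt_top_iff_ne_top.2 (WithTop.add_ne_top.2 ⟨ha0, hb0⟩)
      | succ t =>
        have ht' := IsAdmissible.lt_N_of_succ ht
        obtain ⟨xa, hxa⟩ := exists_forall_ge_map_eq hF hFμ ht' ht hk hac
        obtain ⟨xb, hxb⟩ := exists_forall_ge_map_eq hF hFμ ht' ht hk hbc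
        obtain ⟨xq, hxq⟩ := exists_forall_ge_map_eq hF hFμ ht' ht hk hqc
        obtain ⟨xd, hxd⟩ := exists_forall_ge_map_eq hF hFμ ht' ht hk hdc
        have hlt := (hF.isLimitAugmented ht' ht hk).lt (max (max xa xb) (max xq xd))
        rw [(hT _).value] at hlt
        exact add_lt_of_carry (hFμ.le _) hlt (hT _).le_map_self
          (hxa _ (by simp)) (hxb _ (by simp)) (hxq _ (by simp)) (hxd _ (by simp)) hab ha0 hb0
    | succ k => exact haug _ (hF.isAugmented_b_succ ht (IsAdmissible.lt_len_of_succ hk) hk)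
  · obtain ⟨j, -, -, h⟩ := hF.exists_isAugmented_a ht x
    exact haug j h

/-- The expansion of a key polynomial in the key polynomial of an index of which it is an
augmentation. -/
theorem exists_hasMonicExpansion_of_isAugmented (hμ : TrivialSupport μ)
    (hF : IsAdmissible s ν F Q) (hFμ : IsAdmitted s F Q μ)
    (hT : ∀ i, IsTruncation μ (F i) (Q i) (g i)) {i j : s.Idx}
    (h : IsAugmented (F j) (Q i) (F i)) :
    ∃ r c, HasMonicExpansion μ (F j) (Q j) (Q i) (g j) r c :=
  (hT j).exists_hasMonicExpansion hμ (add_lt_of_carry_index hμ hF hFμ hT j) (hT i).monic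
    (h.lt.trans_le (hFμ.le i _)) fun f hf =>
      (h.map_eq hf).symm.trans (hFμ.eq_of_degree_lt i f hf)

/-- The values attached to `A^(t)`, except possibly the first, are values of polynomials of smaller
degree. -/
theorem isTorsionOver_a (hF : IsAdmissible s ν F Q) (hFμ : IsAdmitted s F Q μ)
    (hT : ∀ i, IsTruncation μ (F i) (Q i) (g i)) {t : ℕ} (ht : (t : ℕ∞) < s.N) {x y : s.A t}
    (hxy : x < y)
    (htors : ∀ f : K[X], f.degree < (Q (s.a ht x)).degree → HasTorsionValue ν μ f) :
    IsTorsionOver ν (g (s.a ht y)) := by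
  have hfam := isContinuedFamily hF hFμ hT ht x
  obtain ⟨z, hz⟩ := hfam.exists_gt y
  obtain ⟨φ, hφ, hdeg, -, heq⟩ := hFμ.exists_monic_of_lt ht hxy
  rw [(hT _).value] at heq
  have hdeg' := hdeg.trans (hF.degree_eq_of_inTail ht z (Shape.inTail_a ht x))
  have hlt := (hT (s.a ht z)).degree_sub_lt hφ hdeg'
  rw [hF.degree_eq_of_inTail ht x (Shape.inTail_a ht z)] at hlt
  refine htors _ hlt _ ?_
  -- `μ φ` is the value of `φ - Q z`, because `μ (Q z)` is greater
  rw [heq, μ.map_sub_eq_of_lt_left]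
  rw [← heq]
  exact (WithTop.coe_lt_coe.2 (hfam.strictMono hz)).trans_le (hT _).le_map_self

theorem hasTorsionValue_b_succ (hF : IsAdmissible s ν F Q) (hFμ : IsAdmitted s F Q μ)
    (hT : ∀ i, IsTruncation μ (F i) (Q i) (g i)) {t : ℕ} (ht : (t : ℕ∞) < s.N) {k : ℕ}
    (hk : (k : ℕ∞) < s.len t) (hk' : ((k + 1 : ℕ) : ℕ∞) < s.len t)
    (h : ∀ f : K[X], f.degree < (Q (s.b ht k hk)).degree → HasTorsionValue ν μ f) {f : K[X]}
    (hf : f.degree < (Q (s.b ht (k + 1) hk')).degree) : HasTorsionValue ν μ f := by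
  have haug := hF.isAugmented_b_succ ht hk hk'
  have heq : ∀ f : K[X], f.degree < (Q (s.b ht (k + 1) hk')).degree →
      F (s.b ht k hk) f = μ f := fun f hf =>
    (haug.map_eq hf).symm.trans (hFμ.eq_of_degree_lt _ f hf)
  have hγ : IsTorsionOver ν (g (s.b ht k hk)) :=
    (hT _).isTorsionOver (heq _ (hF.degree_b_lt ht (Nat.lt_succ_self k) hk hk')).symm h
      (haug.lt.trans_le (hFμ.le _ _))
  intro a ha
  exact (hT (s.b ht k hk)).hasTorsionValue hγ h f a ((heq f hf).trans ha)

theorem hasTorsionValue_limit (hF : IsAdmissible s ν F Q) (hFμ : IsAdmitted s F Q μ)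
    (hT : ∀ i, IsTruncation μ (F i) (Q i) (g i)) {t : ℕ} (ht : (t : ℕ∞) < s.N)
    (ht' : ((t + 1 : ℕ) : ℕ∞) < s.N) (h0 : ((0 : ℕ) : ℕ∞) < s.len (t + 1)) {x : s.A t}
    (h : ∀ f : K[X], f.degree < (Q (s.a ht x)).degree → HasTorsionValue ν μ f) {f : K[X]}
    (hf : f.degree < (Q (s.b ht' 0 h0)).degree) : HasTorsionValue ν μ f := by
  obtain ⟨y, hy⟩ := exists_forall_ge_map_eq hF hFμ ht ht' h0 hf
  obtain ⟨z, hz⟩ := (isContinuedFamily hF hFμ hT ht x).exists_gt (max x y)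
  have hγ := isTorsionOver_a hF hFμ hT ht ((le_max_left x y).trans_lt hz) h
  intro a ha
  rw [← hy z ((le_max_right x y).trans hz.le)] at ha
  refine (hT (s.a ht z)).hasTorsionValue hγ (fun f hf => h f ?_) f a ha
  rwa [hF.degree_eq_of_inTail ht x (Shape.inTail_a ht z)] at hf

/-- The values of the polynomials of degree less than `deg Q_i`, for `i` in some `B^(t)`, are
torsion over the value group of `ν`. -/
theorem hasTorsionValue_b (hF : IsAdmissible s ν F Q) (hFμ : IsAdmitted s F Q μ)
    (hμν : ∀ c : K, μ (C c) = ν c) (hT : ∀ i, IsTruncation μ (F i) (Q i) (g i)) {t : ℕ}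
    (ht : (t : ℕ∞) < s.N) {k : ℕ} (hk : (k : ℕ∞) < s.len t) {f : K[X]}
    (hf : f.degree < (Q (s.b ht k hk)).degree) : HasTorsionValue ν μ f := by
  induction t generalizing k f with
  | zero =>
    induction k generalizing f with
    | zero =>
      intro γ hγ
      have hdeg := (hF.first ht hk).2.1
      have hf0 : f ≠ 0 := by
        rintro rfl
        rw [μ.map_zero] at hγ
        exact WithTop.coe_ne_top hγ.symm
      have hC : f = C (f.coeff 0) := by
        refine eq_C_of_natDegree_eq_zero ?_
        have := natDegree_lt_natDegree hf0 hf
        omega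
      rw [hC] at hγ hf0
      rw [hμν] at hγ
      exact IsTorsionOver.of_map_eq (by simpa using hf0) hγ
    | succ k ih =>
      exact hasTorsionValue_b_succ hF hFμ hT ht (IsAdmissible.lt_len_of_succ hk) hk
        (fun f hf => ih _ hf) hf
  | succ t iht =>
    induction k generalizing f with
    | zero =>
      have ht' := IsAdmissible.lt_N_of_succ ht
      obtain ⟨x⟩ := hF.nondiscrete t ht
      obtain ⟨n, hn, hn'⟩ := hF.exists_last ht' x
      refine hasTorsionValue_limit hF hFμ hT ht' ht hk (x := x) (fun f hf => iht ht' hn ?_) hf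
      rwa [← (hF.simple t ht').degree_eq x n hn hn']
    | succ k ih =>
      exact hasTorsionValue_b_succ hF hFμ hT ht (IsAdmissible.lt_len_of_succ hk) hk
        (fun f hf => ih _ hf) hf

theorem hasTorsionValue_a (hF : IsAdmissible s ν F Q) (hFμ : IsAdmitted s F Q μ)
    (hμν : ∀ c : K, μ (C c) = ν c) (hT : ∀ i, IsTruncation μ (F i) (Q i) (g i)) {t : ℕ}
    (ht : (t : ℕ∞) < s.N) (x : s.A t) {f : K[X]} (hf : f.degree < (Q (s.a ht x)).degree) :
    HasTorsionValue ν μ f := by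
  obtain ⟨n, hn, hn'⟩ := hF.exists_last ht x
  refine hasTorsionValue_b hF hFμ hμν hT ht hn ?_
  rwa [← (hF.simple t ht).degree_eq x n hn hn']

/-- The expansion of the key polynomial of a limit index in a key polynomial of the preceding
tail. -/
theorem exists_hasMonicExpansion_limit (hν : RankOne ν) (hμ : TrivialSupport μ)
    (hF : IsAdmissible s ν F Q) (hFμ : IsAdmitted s F Q μ) (hμν : ∀ c : K, μ (C c) = ν c)
    (hT : ∀ i, IsTruncation μ (F i) (Q i) (g i)) {t : ℕ} (ht : (t : ℕ∞) < s.N)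
    (ht' : ((t + 1 : ℕ) : ℕ∞) < s.N) (h0 : ((0 : ℕ) : ℕ∞) < s.len (t + 1)) {b : K} (hb : b ≠ 0)
    (hbd : F (s.b ht' 0 h0) (Q (s.b ht' 0 h0)) ≤ ν b) :
    ∃ (x : s.A t) (r : ℕ) (c : ℕ → K[X]), HasMonicExpansion μ (F (s.a ht x)) (Q (s.a ht x))
      (Q (s.b ht' 0 h0)) (g (s.a ht x)) r c := by
  obtain ⟨x⟩ := hF.nondiscrete t ht'
  have hfam := isContinuedFamily hF hFμ hT ht x
  obtain ⟨y, hxy⟩ := hfam.exists_gt x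
  have hlim := hF.isLimitAugmented ht ht' h0
  have : Nonempty (s.A t) := ⟨x⟩
  have htors : ∀ z, y ≤ z → IsTorsionOver ν (g (s.a ht z)) := fun z hz =>
    isTorsionOver_a hF hFμ hT ht (hxy.trans_le hz) fun f hf => hasTorsionValue_a hF hFμ hμν hT ht x hf
  exact hfam.exists_hasMonicExpansion hν hμ y htors
    (fun z hz => (hT _).hasTorsionValue (htors z hz) fun f hf =>
      hasTorsionValue_a hF hFμ hμν hT ht z hf)
    (hT _).monic (fun z => (hlim.lt z).trans_le (hFμ.le _ _))
    (fun f hf => exists_forall_ge_map_eq hF hFμ ht ht' h0 hf) hb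
    fun z => (hlim.lt z).le.trans hbd

end Families

end Vaquie

namespace Vaquie

/-! ### Standard expansions -/

section Standard

variable {K : Type*} [Field K] {Γ : Type*} [AddCommGroup Γ] [LinearOrder Γ] [IsOrderedAddMonoid Γ]
variable {ν : AddValuation K (WithTop Γ)} {μ : AddValuation K[X] (WithTop Γ)}
variable {s : Shape} {F : s.Idx → AddValuation K[X] (WithTop Γ)} {Q : s.Idx → K[X]}
variable {g : s.Idx → Γ}

theorem monomialOf_zero (Q : s.Idx → K[X]) (e : s.Idx →₀ ℕ) : monomialOf Q (0 : K) e = 0 := by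
  simp [monomialOf]

theorem monomialOf_add (Q : s.Idx → K[X]) (a b : K) (e : s.Idx →₀ ℕ) :
    monomialOf Q (a + b) e = monomialOf Q a e + monomialOf Q b e := by
  simp [monomialOf, add_mul]

theorem monomialOf_add_single (Q : s.Idx → K[X]) (a : K) (e : s.Idx →₀ ℕ) (p : s.Idx) (m : ℕ) :
    monomialOf Q a (e + Finsupp.single p m) = monomialOf Q a e * Q p ^ m := by
  classical
  have h : (Finsupp.single p m).prod (fun j n => Q j ^ n) = Q p ^ m :=
    Finsupp.prod_single_index (pow_zero _)
  rw [monomialOf, monomialOf, Finsupp.prod_add_index' (fun _ => pow_zero _)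
    (fun _ _ _ => pow_add _ _ _), h, mul_assoc]

/-- The sums of `l`-standard monomials not involving `Q_l`, of value at least `w`. -/
noncomputable def standardSums (μ : AddValuation K[X] (WithTop Γ)) (Q : s.Idx → K[X]) (l : s.Idx)
    (w : WithTop Γ) : AddSubmonoid K[X] :=
  AddSubmonoid.closure {f | ∃ a e, IsStandardExponent Q l e ∧ w ≤ μ (monomialOf Q a e) ∧
    f = monomialOf Q a e}

theorem exists_finsupp_of_mem_standardSums {l : s.Idx} {w : WithTop Γ} {f : K[X]}
    (hf : f ∈ standardSums μ Q l w) :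
    ∃ c : (s.Idx →₀ ℕ) →₀ K, f = c.sum (fun e a => monomialOf Q a e) ∧
      ∀ e ∈ c.support, IsStandardExponent Q l e ∧ w ≤ μ (monomialOf Q (c e) e) := by
  classical
  induction hf using AddSubmonoid.closure_induction with
  | mem f hf =>
    obtain ⟨a, e, he, hw, rfl⟩ := hf
    refine ⟨Finsupp.single e a, ?_, fun e' he' => ?_⟩
    · rw [Finsupp.sum_single_index (monomialOf_zero Q e)]
    · obtain rfl : e' = e := by simpa using Finsupp.support_single_subset he'
      rw [Finsupp.single_eq_same]
      exact ⟨he, hw⟩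
  | zero => exact ⟨0, by simp, by simp⟩
  | add f h _ _ hf hh =>
    obtain ⟨c, rfl, hc⟩ := hf
    obtain ⟨d, rfl, hd⟩ := hh
    have hval : ∀ (c : (s.Idx →₀ ℕ) →₀ K),
        (∀ e ∈ c.support, IsStandardExponent Q l e ∧ w ≤ μ (monomialOf Q (c e) e)) →
        ∀ e, w ≤ μ (monomialOf Q (c e) e) := fun c hc e => by
      by_cases he : e ∈ c.support
      · exact (hc e he).2
      · rw [Finsupp.notMem_support_iff.1 he, monomialOf_zero, μ.map_zero]
        exact le_top
    refine ⟨c + d, ?_, fun e he => ⟨?_, ?_⟩⟩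
    · rw [Finsupp.sum_add_index' (monomialOf_zero Q) fun e a b => monomialOf_add Q a b e]
    · rcases Finset.mem_union.1 (Finsupp.support_add he) with h | h
      · exact (hc e h).1
      · exact (hd e h).1
    · rw [Finsupp.add_apply, monomialOf_add]
      exact μ.map_le_add (hval c hc e) (hval d hd e)

/-- If `F p` computes `μ f`, then standard expansions of the coefficients of the `Q_p`-expansion
of `f` combine to a standard expansion of `f`. -/
theorem mem_standardSums_of_expansion {γ : Γ} {G : AddValuation K[X] (WithTop Γ)} {p l : s.Idx}
    (hT : IsTruncation μ G (Q p) γ)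
    (ih : ∀ f : K[X], f.degree < (Q p).degree → f ∈ standardSums μ Q p (μ f))
    (hdeg : (Q l).natDegree = alpha Q p l * (Q p).natDegree) (hl : 0 < (Q l).natDegree)
    (hstep : ∀ e m, IsStandardExponent Q p e → m < alpha Q p l →
      IsStandardExponent Q l (e + Finsupp.single p m))
    {f : K[X]} (hf : f.degree < (Q l).degree) (hGf : G f = μ f) :
    f ∈ standardSums μ Q l (μ f) := by
  obtain ⟨n, hn⟩ : ∃ n, alpha Q p l = n + 1 := by
    refine Nat.exists_eq_succ_of_ne_zero fun h0 => ?_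
    rw [h0, zero_mul] at hdeg
    omega
  have hnat : f.natDegree < (n + 1) * (Q p).natDegree := by
    rw [← hn, ← hdeg]
    by_cases h0 : f = 0
    · simpa [h0] using hl
    · exact natDegree_lt_natDegree h0 hf
  obtain ⟨c, hc, hfc⟩ := exists_expansion hT.monic n f hnat
  have hle : ∀ j < n + 1, μ f ≤ μ (c j) + j • (γ : WithTop Γ) := fun j hj => by
    rw [← hGf]
    conv_lhs => rw [hfc]
    exact hT.map_le hc hj
  have hmul : ∀ j < n + 1, c j * Q p ^ j ∈ standardSums μ Q l (μ f) := by
    intro j hj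
    suffices key : ∀ w h, h ∈ standardSums μ Q p w → μ f ≤ w + j • (γ : WithTop Γ) →
        h * Q p ^ j ∈ standardSums μ Q l (μ f) from key _ _ (ih (c j) (hc j)) (hle j hj)
    intro w h hmem hlej
    induction hmem using AddSubmonoid.closure_induction with
    | mem h hh =>
      obtain ⟨a, e, he, hw, rfl⟩ := hh
      refine AddSubmonoid.subset_closure ⟨a, e + Finsupp.single p j, hstep e j he (by omega), ?_,
        (monomialOf_add_single Q a e p j).symm⟩
      rw [monomialOf_add_single, μ.map_mul, μ.map_pow]
      refine hlej.trans (add_le_add hw ?_)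
      exact nsmul_le_nsmul_right hT.le_map_self j
    | zero => simp
    | add a b _ _ ha hb =>
      rw [add_mul]
      exact AddSubmonoid.add_mem _ ha hb
  have hsum := AddSubmonoid.sum_mem _ fun j hj => hmul j (Finset.mem_range.1 hj)
  rwa [← hfc] at hsum

/-- A power of `Q_p` may be added to a `p`-standard monomial to make it `l`-standard, if `l` is the
only index `i > p` of the form `j+` relatively to `l`, and `p` is the only `j` with `l = j+` which is
involved. -/
theorem isStandardExponent_add_single {p l : s.Idx} (hpl : p < l)
    (hα : ∀ j i, s.IsPlus l j i → 0 < alpha Q j i)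
    (hsmall : ∀ j i, s.IsPlus l j i → i ≤ p → s.IsPlus p j i) {e : s.Idx →₀ ℕ}
    (hlast : ∀ j i, s.IsPlus l j i → p < i → i = l ∧ (j = p ∨ e j = 0))
    (he : IsStandardExponent Q p e) {m : ℕ} (hm : m < alpha Q p l) :
    IsStandardExponent Q l (e + Finsupp.single p m) := by
  have hep : e p = 0 := by
    by_contra h
    exact lt_irrefl _ (he.lt_of_ne_zero p h)
  have hval : ∀ j, j ≠ p → (e + Finsupp.single p m) j = e j := fun j hj => by
    rw [Finsupp.add_apply, Finsupp.single_eq_of_ne hj, add_zero]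
  refine ⟨fun j hj => ?_, fun j i h => ?_, fun j j' i h h' hj hj' => ?_⟩
  · by_cases hjp : j = p
    · rwa [hjp]
    · rw [hval j hjp] at hj
      exact (he.lt_of_ne_zero j hj).trans hpl
  · rcases le_or_gt i p with hi | hi
    · rw [hval j (h.1.trans_le hi).ne]
      exact he.lt_alpha j i (hsmall j i h hi)
    · obtain ⟨rfl, hjp⟩ := hlast j i h hi
      by_cases hj : j = p
      · rw [hj, Finsupp.add_apply, hep, Finsupp.single_eq_same, zero_add]
        exact hm
      · rw [hval j hj, hjp.resolve_left hj]
        exact hα j i h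
  · rcases le_or_gt i p with hi | hi
    · rw [hval j (h.1.trans_le hi).ne] at hj
      rw [hval j' (h'.1.trans_le hi).ne] at hj'
      exact he.unique j j' i (hsmall j i h hi) (hsmall j' i h' hi) hj hj'
    · have key : ∀ j : s.Idx, s.IsPlus l j i → (e + Finsupp.single p m) j ≠ 0 → j = p := by
        intro j h hj
        by_contra hjp
        rw [hval j hjp] at hj
        exact hj (((hlast j i h hi).2).resolve_left hjp)
      rw [key j h hj, key j' h' hj']

theorem isStandardExponent_zero (hF : IsAdmissible s ν F Q) (hFμ : IsAdmitted s F Q μ)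
    (hT : ∀ i, IsTruncation μ (F i) (Q i) (g i)) (l : s.Idx) : IsStandardExponent Q l 0 :=
  ⟨fun _ hj => absurd rfl hj, fun _ _ h => alpha_pos hF hFμ hT h, fun _ _ _ _ _ h => absurd rfl h⟩

/-- For `l` outside of the sets `A^(t)`, the relation `i = j+` relatively to `l` is inherited by
smaller indices. -/
theorem Shape.IsPlus.of_le_b {t : ℕ} {ht : (t : ℕ∞) < s.N} {k : ℕ} {hk : (k : ℕ∞) < s.len t}
    {j i p : s.Idx} (h : s.IsPlus (s.b ht k hk) j i) (hi : i ≤ p) : s.IsPlus p j i := by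
  obtain ⟨h1, -, h | ⟨u, hu, x, y, -, -, h⟩ | h⟩ := h
  · exact ⟨h1, hi, Or.inl h⟩
  · exact absurd h.symm Shape.a_ne_b
  · exact ⟨h1, hi, Or.inr (Or.inr h)⟩

theorem isStandardExponent_b_succ (hF : IsAdmissible s ν F Q) (hFμ : IsAdmitted s F Q μ)
    (hT : ∀ i, IsTruncation μ (F i) (Q i) (g i)) {t : ℕ} (ht : (t : ℕ∞) < s.N) {k : ℕ}
    (hk : (k : ℕ∞) < s.len t) (hk' : ((k + 1 : ℕ) : ℕ∞) < s.len t) {e : s.Idx →₀ ℕ} {m : ℕ}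
    (he : IsStandardExponent Q (s.b ht k hk) e)
    (hm : m < alpha Q (s.b ht k hk) (s.b ht (k + 1) hk')) :
    IsStandardExponent Q (s.b ht (k + 1) hk') (e + Finsupp.single (s.b ht k hk) m) := by
  refine isStandardExponent_add_single ((Shape.b_lt_b_iff ht).2 (Nat.lt_succ_self k))
    (fun j i h => alpha_pos hF hFμ hT h) (fun j i h hi => h.of_le_b hi) (fun j i h hi => ?_) he hm
  obtain ⟨-, hil, ⟨u, hu, n, hn, hn', rfl, rfl⟩ | ⟨u, hu, x, y, -, -, h⟩ | ⟨u, hu, h0, -, rfl⟩⟩ := h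
  · obtain rfl : t = u := le_antisymm (Shape.blockOf_le hi.le) (Shape.blockOf_le hil)
    have h1 := (Shape.b_lt_b_iff ht).1 hi
    have h2 : n + 1 ≤ k + 1 := by
      by_contra! h2
      exact absurd hil ((Shape.b_lt_b_iff ht).2 h2).not_ge
    obtain rfl : n = k := by omega
    exact ⟨rfl, Or.inl rfl⟩
  · exact absurd h.symm Shape.a_ne_b
  · obtain rfl : t = u + 1 := le_antisymm (Shape.blockOf_le hi.le) (Shape.blockOf_le hil)
    exact absurd ((Shape.b_lt_b_iff ht).1 hi) (Nat.not_lt_zero _)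

theorem isStandardExponent_limit (hF : IsAdmissible s ν F Q) (hFμ : IsAdmitted s F Q μ)
    (hT : ∀ i, IsTruncation μ (F i) (Q i) (g i)) {t : ℕ} (ht : (t : ℕ∞) < s.N)
    (ht' : ((t + 1 : ℕ) : ℕ∞) < s.N) (h0 : ((0 : ℕ) : ℕ∞) < s.len (t + 1)) (x : s.A t)
    {e : s.Idx →₀ ℕ} {m : ℕ} (he : IsStandardExponent Q (s.a ht x) e)
    (hm : m < alpha Q (s.a ht x) (s.b ht' 0 h0)) :
    IsStandardExponent Q (s.b ht' 0 h0) (e + Finsupp.single (s.a ht x) m) := by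
  refine isStandardExponent_add_single (Shape.idx_lt_idx_of_lt ht ht' (Nat.lt_succ_self t) _ _)
    (fun j i h => alpha_pos hF hFμ hT h) (fun j i h hi => h.of_le_b hi) (fun j i h hi => ?_) he hm
  obtain ⟨-, hil, ⟨u, hu, n, hn, hn', rfl, rfl⟩ | ⟨u, hu, y, z, -, -, h⟩ | ⟨u, hu, h0', hj, rfl⟩⟩ := h
  · exfalso
    have h1 : t ≤ u := Shape.blockOf_le hi.le
    have h2 : u ≤ t + 1 := Shape.blockOf_le hil
    rcases h1.eq_or_lt with rfl | h3
    · exact absurd hi (Shape.b_lt_a ht hn' x).not_gt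
    · obtain rfl : u = t + 1 := by omega
      exact absurd hil ((Shape.b_lt_b_iff hu).2 (Nat.succ_pos n)).not_ge
  · exact absurd h.symm Shape.a_ne_b
  · have h1 : t ≤ u + 1 := Shape.blockOf_le hi.le
    have h2 : u + 1 ≤ t + 1 := Shape.blockOf_le hil
    rcases h1.eq_or_lt with rfl | h3
    · exact absurd hi (Shape.b_lt_a ht h0' x).not_gt
    obtain rfl : u = t := by omega
    refine ⟨rfl, ?_⟩
    rcases lt_trichotomy j (s.a ht x) with h | h | h
    · -- relatively to an element of the tail, the exponents in the tail are less than `1`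
      have h4 := he.lt_alpha j (s.a ht x) ⟨h, le_rfl, Or.inr (Or.inl ⟨u, ht, x, x, hj, rfl, rfl⟩)⟩
      rw [alpha, natDegree_eq_of_degree_eq (hF.degree_eq_of_inTail ht x hj),
        Nat.div_self (hT _).natDegree_pos] at h4
      exact Or.inr (Nat.lt_one_iff.1 h4)
    · exact Or.inl h
    · right
      by_contra h5
      exact absurd (he.lt_of_ne_zero j h5) h.not_gt

/-- A monomial which is standard for the last element of `B^(t)` is standard for the elements of
`A^(t)`, as it involves no element of the tail. -/
theorem isStandardExponent_a (hF : IsAdmissible s ν F Q) (hFμ : IsAdmitted s F Q μ)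
    (hT : ∀ i, IsTruncation μ (F i) (Q i) (g i)) {t : ℕ} (ht : (t : ℕ∞) < s.N) (x : s.A t) {n : ℕ}
    (hn : (n : ℕ∞) < s.len t) (hn' : (n : ℕ∞) + 1 = s.len t) {e : s.Idx →₀ ℕ}
    (he : IsStandardExponent Q (s.b ht n hn) e) : IsStandardExponent Q (s.a ht x) e := by
  have key : ∀ j i, s.IsPlus (s.a ht x) j i → s.IsPlus (s.b ht n hn) j i ∨ e j = 0 := by
    rintro j i ⟨hji, hil, ⟨u, hu, k, hk, hk', rfl, rfl⟩ | ⟨u, hu, y, z, hj, rfl, h⟩ |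
      ⟨u, hu, h0, hj, rfl⟩⟩
    · left
      refine ⟨hji, ?_, Or.inl ⟨u, hu, k, hk, hk', rfl, rfl⟩⟩
      have hut : u ≤ t := Shape.blockOf_le hil
      rcases hut.eq_or_lt with rfl | h
      · rw [← not_lt, Shape.b_lt_b_iff, not_lt]
        rw [← hn'] at hk'
        have : k + 1 < n + 1 := by exact_mod_cast hk'
        omega
      · exact (Shape.idx_lt_idx_of_lt hu ht h _ _).le
    · obtain rfl : t = u := congrArg Shape.blockOf h
      right
      by_contra h0
      exact absurd (he.lt_of_ne_zero j h0) hj.b_le.not_gt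
    · left
      refine ⟨hji, ?_, Or.inr (Or.inr ⟨u, hu, h0, hj, rfl⟩)⟩
      have hut : u + 1 ≤ t := Shape.blockOf_le hil
      rcases hut.eq_or_lt with rfl | h
      · rw [← not_lt, Shape.b_lt_b_iff, not_lt]
        exact Nat.zero_le _
      · exact (Shape.idx_lt_idx_of_lt hu ht h _ _).le
  refine ⟨fun j hj => (he.lt_of_ne_zero j hj).trans (Shape.b_lt_a ht hn x), fun j i h => ?_,
    fun j j' i h h' hj hj' => ?_⟩
  · rcases key j i h with h1 | h1
    · exact he.lt_alpha j i h1
    · rw [h1]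
      exact alpha_pos hF hFμ hT h
  · exact he.unique j j' i ((key j i h).resolve_right hj) ((key j' i h').resolve_right hj') hj hj'

theorem HasMonicExpansion.alpha_eq (hT : ∀ i, IsTruncation μ (F i) (Q i) (g i)) {j i : s.Idx}
    {r : ℕ} {c : ℕ → K[X]} (h : HasMonicExpansion μ (F j) (Q j) (Q i) (g j) r c) :
    alpha Q j i = r := by
  rw [alpha, h.natDegree, Nat.mul_div_cancel _ (hT j).natDegree_pos]

theorem mem_standardSums_a (hF : IsAdmissible s ν F Q) (hFμ : IsAdmitted s F Q μ)
    (hT : ∀ i, IsTruncation μ (F i) (Q i) (g i)) {t : ℕ} (ht : (t : ℕ∞) < s.N) (x : s.A t) {n : ℕ}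
    (hn : (n : ℕ∞) < s.len t) (hn' : (n : ℕ∞) + 1 = s.len t)
    (h : ∀ f : K[X], f.degree < (Q (s.b ht n hn)).degree →
      f ∈ standardSums μ Q (s.b ht n hn) (μ f)) {f : K[X]}
    (hf : f.degree < (Q (s.a ht x)).degree) : f ∈ standardSums μ Q (s.a ht x) (μ f) := by
  rw [(hF.simple t ht).degree_eq x n hn hn'] at hf
  refine AddSubmonoid.closure_mono ?_ (h f hf)
  rintro _ ⟨a, e, he, hw, rfl⟩
  exact ⟨a, e, isStandardExponent_a hF hFμ hT ht x hn hn' he, hw, rfl⟩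

theorem mem_standardSums_b_succ (hμ : TrivialSupport μ) (hF : IsAdmissible s ν F Q)
    (hFμ : IsAdmitted s F Q μ) (hT : ∀ i, IsTruncation μ (F i) (Q i) (g i)) {t : ℕ}
    (ht : (t : ℕ∞) < s.N) {k : ℕ} (hk : (k : ℕ∞) < s.len t) (hk' : ((k + 1 : ℕ) : ℕ∞) < s.len t)
    (h : ∀ f : K[X], f.degree < (Q (s.b ht k hk)).degree →
      f ∈ standardSums μ Q (s.b ht k hk) (μ f)) {f : K[X]}
    (hf : f.degree < (Q (s.b ht (k + 1) hk')).degree) :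
    f ∈ standardSums μ Q (s.b ht (k + 1) hk') (μ f) := by
  have haug := hF.isAugmented_b_succ ht hk hk'
  obtain ⟨r, c, hrc⟩ := exists_hasMonicExpansion_of_isAugmented hμ hF hFμ hT haug
  refine mem_standardSums_of_expansion (hT _) h ?_ (hT _).natDegree_pos
    (fun e m he hm => isStandardExponent_b_succ hF hFμ hT ht hk hk' he hm) hf
    ((haug.map_eq hf).symm.trans (hFμ.eq_of_degree_lt _ f hf))
  rw [hrc.alpha_eq hT, hrc.natDegree]

/-- Every polynomial `f` of degree less than `deg Q_l` is a sum of `l`-standard monomials not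
involving `Q_l`, of value at least `μ f`; here `l` lies in some `B^(t)`. -/
theorem mem_standardSums_b (hν : RankOne ν) (hμ : TrivialSupport μ) (hμν : ∀ c : K, μ (C c) = ν c)
    (hF : IsAdmissible s ν F Q) (hFμ : IsAdmitted s F Q μ)
    (hT : ∀ i, IsTruncation μ (F i) (Q i) (g i))
    (hbdd : ∀ i, s.IsLimitIdx i → ∃ c : K, c ≠ 0 ∧ F i (Q i) ≤ ν c) {t : ℕ} (ht : (t : ℕ∞) < s.N)
    {k : ℕ} (hk : (k : ℕ∞) < s.len t) {f : K[X]} (hf : f.degree < (Q (s.b ht k hk)).degree) :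
    f ∈ standardSums μ Q (s.b ht k hk) (μ f) := by
  induction t generalizing k f with
  | zero =>
    induction k generalizing f with
    | zero =>
      have hdeg := (hF.first ht hk).2.1
      have hC : f = C (f.coeff 0) := by
        refine eq_C_of_natDegree_eq_zero ?_
        by_cases h0 : f = 0
        · simp [h0]
        · have := natDegree_lt_natDegree h0 hf
          omega
      have hmon : monomialOf Q (f.coeff 0) 0 = f := by
        rw [monomialOf, Finsupp.prod_zero_index, mul_one, ← hC]
      exact AddSubmonoid.subset_closure ⟨f.coeff 0, 0, isStandardExponent_zero hF hFμ hT _,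
        by rw [hmon], hmon.symm⟩
    | succ k ih =>
      exact mem_standardSums_b_succ hμ hF hFμ hT ht (IsAdmissible.lt_len_of_succ hk) hk
        (fun f hf => ih _ hf) hf
  | succ t iht =>
    induction k generalizing f with
    | zero =>
      have ht' := IsAdmissible.lt_N_of_succ ht
      obtain ⟨b, hb, hbd⟩ := hbdd (s.b ht 0 hk) ⟨t, ht, hk, rfl⟩
      obtain ⟨x, r, c, hrc⟩ :=
        exists_hasMonicExpansion_limit hν hμ hF hFμ hμν hT ht' ht hk hb hbd
      obtain ⟨y, hy⟩ := exists_forall_ge_map_eq hF hFμ ht' ht hk hf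
      obtain ⟨n, hn, hn'⟩ := hF.exists_last ht' x
      refine mem_standardSums_of_expansion (hT (s.a ht' y))
        (fun f hf => mem_standardSums_a hF hFμ hT ht' y hn hn' (fun f hf => iht ht' hn hf) hf)
        ?_ (hT _).natDegree_pos
        (fun e m he hm => isStandardExponent_limit hF hFμ hT ht' ht hk y he hm) hf (hy y le_rfl)
      have hxy := natDegree_eq_of_degree_eq
        (hF.degree_eq_of_inTail ht' x (Shape.inTail_a ht' y))
      rw [alpha, hxy, hrc.natDegree, Nat.mul_div_cancel _ (hT _).natDegree_pos]
    | succ k ih =>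
      exact mem_standardSums_b_succ hμ hF hFμ hT ht (IsAdmissible.lt_len_of_succ hk) hk
        (fun f hf => ih _ hf) hf

theorem mem_standardSums (hν : RankOne ν) (hμ : TrivialSupport μ) (hμν : ∀ c : K, μ (C c) = ν c)
    (hF : IsAdmissible s ν F Q) (hFμ : IsAdmitted s F Q μ)
    (hT : ∀ i, IsTruncation μ (F i) (Q i) (g i))
    (hbdd : ∀ i, s.IsLimitIdx i → ∃ c : K, c ≠ 0 ∧ F i (Q i) ≤ ν c) (l : s.Idx) {f : K[X]}
    (hf : f.degree < (Q l).degree) : f ∈ standardSums μ Q l (μ f) := by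
  rcases Shape.eq_b_or_eq_a l with ⟨t, ht, k, hk, rfl⟩ | ⟨t, ht, x, rfl⟩
  · exact mem_standardSums_b hν hμ hμν hF hFμ hT hbdd ht hk hf
  · obtain ⟨n, hn, hn'⟩ := hF.exists_last ht x
    exact mem_standardSums_a hF hFμ hT ht x hn hn'
      (fun f hf => mem_standardSums_b hν hμ hμν hF hFμ hT hbdd ht hn hf) hf

/-- A monic `Q_j`-expansion of `Q_i`, with its coefficients written as sums of standard
monomials. -/
theorem HasMonicExpansion.exists_standard (hT : ∀ i, IsTruncation μ (F i) (Q i) (g i))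
    {i j : s.Idx}
    (hstd : ∀ f : K[X], f.degree < (Q j).degree → f ∈ standardSums μ Q j (μ f)) {r : ℕ}
    {c : ℕ → K[X]} (h : HasMonicExpansion μ (F j) (Q j) (Q i) (g j) r c)
    (hlt : F j (Q i) < F i (Q i)) :
    ∃ α : ℕ, 0 < α ∧ α = alpha Q j i ∧
      (∃ c : ℕ → (s.Idx →₀ ℕ) →₀ K,
        Q i = Q j ^ α +
          ∑ k ∈ Finset.range α, ((c k).sum fun e a => monomialOf Q a e) * Q j ^ k ∧
        (∀ k < α, ∀ e ∈ (c k).support, IsStandardExponent Q j e) ∧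
        (∀ k < α, ∀ e ∈ (c k).support,
          α • F j (Q j) ≤ k • F j (Q j) + μ (monomialOf Q (c k e) e))) ∧
      α • F j (Q j) < F i (Q i) := by
  choose d hd hd' using fun k => exists_finsupp_of_mem_standardSums (hstd (c k) (h.degree_lt k))
  rw [(hT j).value]
  refine ⟨r, ?_, (h.alpha_eq hT).symm, ⟨d, ?_, fun k _ e he => (hd' k e he).1, fun k hk e he => ?_⟩,
    h.value ▸ hlt⟩
  · refine Nat.pos_of_ne_zero fun h0 => ?_
    have h1 := h.natDegree
    rw [h0, zero_mul] at h1
    exact (hT i).natDegree_pos.ne' h1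
  · rw [h.eq]
    congr 1
    exact Finset.sum_congr rfl fun k _ => by rw [← hd k]
  · refine (h.le k hk).trans ?_
    rw [add_comm]
    gcongr
    exact (hd' k e he).2

end Standard

end Vaquie

/-! ### The expansion of the key polynomials -/

/-- An index `i` which is neither the smallest one nor a limit index is an augmentation of some `j`
with `i = j+`. -/
theorem Vaquie.IsAdmissible.exists_isPlus_isAugmented {K : Type*} [Field K] {Γ : Type*}
    [AddCommGroup Γ] [LinearOrder Γ] [IsOrderedAddMonoid Γ] {ν : AddValuation K (WithTop Γ)}
    {s : Vaquie.Shape} {F : s.Idx → AddValuation K[X] (WithTop Γ)} {Q : s.Idx → K[X]}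
    (hF : Vaquie.IsAdmissible s ν F Q) {i : s.Idx} (hi : ¬ IsMin i) (hlim : ¬ s.IsLimitIdx i) :
    ∃ j, s.IsPlus i j i ∧ Vaquie.IsAugmented (F j) (Q i) (F i) := by
  rcases Vaquie.Shape.eq_b_or_eq_a i with ⟨t, ht, k, hk, rfl⟩ | ⟨t, ht, x, rfl⟩
  · cases k with
    | zero =>
      cases t with
      | zero => exact absurd (Vaquie.Shape.isMin_b_zero ht hk) hi
      | succ t => exact absurd ⟨t, ht, hk, rfl⟩ hlim
    | succ k =>
      have hk' := Vaquie.IsAdmissible.lt_len_of_succ hk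
      exact ⟨s.b ht k hk', ⟨(Vaquie.Shape.b_lt_b_iff ht).2 (Nat.lt_succ_self k), le_rfl,
        Or.inl ⟨t, ht, k, hk', hk, rfl, rfl⟩⟩, hF.isAugmented_b_succ ht hk' hk⟩
  · obtain ⟨j, hj, htail, h⟩ := hF.exists_isAugmented_a ht x
    exact ⟨j, ⟨hj, le_rfl, Or.inr (Or.inl ⟨t, ht, x, x, htail, rfl, rfl⟩)⟩, h⟩

theorem mainTheorem4 {K : Type*} [Field K]
    {Γ : Type*} [AddCommGroup Γ] [LinearOrder Γ] [IsOrderedAddMonoid Γ]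
    (ν : AddValuation K (WithTop Γ)) (hν : Vaquie.RankOne ν)
    (μ : AddValuation K[X] (WithTop Γ)) (hμ : Vaquie.TrivialSupport μ)
    (hμν : ∀ c : K, μ (C c) = ν c)
    (s : Vaquie.Shape) (F : s.Idx → AddValuation K[X] (WithTop Γ)) (Q : s.Idx → K[X])
    (hF : Vaquie.IsAdmissible s ν F Q) (hFμ : Vaquie.IsAdmitted s F Q μ)
    (hbdd : ∀ i, s.IsLimitIdx i → ∃ c : K, c ≠ 0 ∧ F i (Q i) ≤ ν c)
    (i : s.Idx) (hi : ¬ IsMin i) :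
    ∃ i₀ : s.Idx, i₀ < i ∧ s.IsPlus i i₀ i ∧
      ∃ α : ℕ, 0 < α ∧ α = Vaquie.alpha Q i₀ i ∧
      (∃ c : ℕ → (s.Idx →₀ ℕ) →₀ K,
        Q i = Q i₀ ^ α +
          ∑ j ∈ Finset.range α, ((c j).sum fun e a => Vaquie.monomialOf Q a e) * Q i₀ ^ j ∧
        (∀ j < α, ∀ e ∈ (c j).support, Vaquie.IsStandardExponent Q i₀ e) ∧
        (∀ j < α, ∀ e ∈ (c j).support,
          α • F i₀ (Q i₀) ≤ j • F i₀ (Q i₀) + μ (Vaquie.monomialOf Q (c j e) e))) ∧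
      α • F i₀ (Q i₀) < F i (Q i) ∧
      F i₀ (Q i) < μ (Q i) ∧
      (¬ s.IsLimitIdx i → ∀ f : K[X], F i₀ f < μ f → (Q i).degree ≤ f.degree) ∧
      (s.IsLimitIdx i → (∀ i' < i, F i' (Q i) < μ (Q i)) ∧
        ∀ f : K[X], (∀ i' < i, F i' f < μ f) → (Q i).degree ≤ f.degree) := by
  choose g hT using hF.exists_isTruncation hFμ hμν
  have hstd : ∀ l f, f.degree < (Q l).degree → f ∈ Vaquie.standardSums μ Q l (μ f) := fun l f hf =>
    Vaquie.mem_standardSums hν hμ hμν hF hFμ hT hbdd l hf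
  by_cases hlim : s.IsLimitIdx i
  · have hlim' := hlim
    obtain ⟨t, ht, h0, rfl⟩ := hlim
    have ht' := Vaquie.IsAdmissible.lt_N_of_succ ht
    obtain ⟨b, hb, hbd⟩ := hbdd _ hlim'
    obtain ⟨x, r, c, hrc⟩ :=
      Vaquie.exists_hasMonicExpansion_limit hν hμ hF hFμ hμν hT ht' ht h0 hb hbd
    have hlt := (hF.isLimitAugmented ht' ht h0).lt
    have hltμ : ∀ y, F (s.a ht' y) (Q (s.b ht 0 h0)) < μ (Q (s.b ht 0 h0)) := fun y =>
      (hlt y).trans_le (hFμ.le _ _)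
    have htail : ∀ y, s.a ht' y < s.b ht 0 h0 := fun y =>
      Vaquie.Shape.idx_lt_idx_of_lt ht' ht (Nat.lt_succ_self t) _ _
    obtain ⟨α, h1, h2, h3, h4⟩ := hrc.exists_standard hT (hstd _) (hlt x)
    refine ⟨s.a ht' x, htail x, ⟨htail x, le_rfl, Or.inr (Or.inr ⟨t, ht, h0,
      Vaquie.Shape.inTail_a ht' x, rfl⟩)⟩, α, h1, h2, h3, h4, hltμ x,
      fun h => absurd hlim' h, fun _ => ⟨fun j hj => ?_, fun f hf => ?_⟩⟩
    · obtain ⟨y, hy⟩ := Vaquie.exists_le_tail hF hFμ hT ht' ht h0 hj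
      exact (hy _).trans_lt (hltμ y)
    · by_contra! hdeg
      obtain ⟨y, hy⟩ := Vaquie.exists_forall_ge_map_eq hF hFμ ht' ht h0 hdeg
      exact (hf (s.a ht' y) (htail y)).ne (hy y le_rfl)
  · obtain ⟨j, hplus, hj⟩ := hF.exists_isPlus_isAugmented hi hlim
    obtain ⟨r, c, hrc⟩ := Vaquie.exists_hasMonicExpansion_of_isAugmented hμ hF hFμ hT hj
    obtain ⟨α, h1, h2, h3, h4⟩ := hrc.exists_standard hT (hstd j) hj.lt
    refine ⟨j, hplus.1, hplus, α, h1, h2, h3, h4, hj.lt.trans_le (hFμ.le _ _), fun _ f hf => ?_,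
      fun h => absurd h hlim⟩
    by_contra! hlt
    exact hf.ne ((hj.map_eq hlt).symm.trans (hFμ.eq_of_degree_lt i f hlt))
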